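/- All graphs are finite, undirected and simple. For a graph $G$ let $D(G)$ be the set of vertices missed by some maximum matching of $G$, let $A(G)$ be the set of vertices outside $D(G)$ that have a neighbour in $D(G)$, and let $C(G)=V(G)\setminus(D(G)\cup A(G))$. For $S\subseteq V(G)$ let $N(S)$ be the set of vertices having a neighbour in $S$, let $\partial_G(S)$ be the set of vertices of $S$ having a neighbour outside $S$, and let $d_G(S)=|S|-|N(S)|$. A \emph{critical independent set} is an independent set $S$ with $d_G(S)=\max\{d_G(T): T \text{ independent}\}$; a \emph{maximum} critical independent set is one of largest cardinality. Let $\mathrm{nucleus}(G)$ be the intersection of all maximum critical independent sets of $G$, and $\mathrm{diadem}(G)$ the union of all critical independent sets of $G$. A graph is \emph{almost bipartite} if it has exactly one odd cycle, and \emph{König--Egerváry} if $\alpha(G)+\mu(G)=|V(G)|$, where $\alpha(G)$ is the largest size of an independent set and $\mu(G)$ the largest size of a matching. For a matching $M$, an \emph{$M$-blossom} is an odd cycle of length $2k+1$ with exactly $k$ edges in $M$; its \emph{base} is its vertex that is incident with none of these $k$ edges. An \emph{$M$-flower} is an $M$-blossom together with an $M$-alternating path of even (possibly zero) length from the base to a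 vertex not saturated by $M$, the base being the only common vertex of the path and the blossom. For an odd cycle $C$ of $G$, $R(C)$ is the union of the vertex sets of all $M$-flowers with blossom $C$, over all maximum matchings $M$ of $G$. A \emph{BAB-graph} is a graph $G$ obtained from the disjoint union of graphs $B,G_1,\dots,G_k$ ($k\ge 0$), where $B$ is a (possibly empty) bipartite graph and each $G_i$ is an almost bipartite non-König--Egerváry graph whose unique odd cycle $C_i$ satisfies $R(C_i)=V(G_i)$ (computed in $G_i$), by adding edges between vertices belonging to different graphs of the list, in such a way that $$\partial_G(V(B))\subseteq A(B)\cup C(B)\quad\text{and}\quad \partial_G(V(G_i))\subseteq A(G_i)\ \ (i=1,\dots,k).$$ \textbf{Theorem.} Let $G$ be a BAB-graph, and let $X$ be the set of isolated vertices of the induced subgraph $G[D(G)]$. Then $$\mathrm{nucleus}(G)=X .$$ Consequently, $\mathrm{nucleus}(G)\subseteq \mathrm{diadem}(G)$. -/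

import Mathlib

namespace BABGraph

universe u

variable {V : Type u}

/-- The neighbourhood `N(S)`: all vertices having a neighbour in `S`. -/
def nbhd (G : SimpleGraph V) (S : Set V) : Set V :=
  {w | ∃ v ∈ S, G.Adj v w}

/-- The difference `d_G(S) = |S| - |N(S)|`. -/
noncomputable def diff (G : SimpleGraph V) (S : Set V) : ℤ :=
  (S.ncard : ℤ) - ((nbhd G S).ncard : ℤ)

/-- A critical independent set: an independent set whose difference is the maximum
of the differences of the independent sets of `G`. -/
def IsCriticalIndepSet (G : SimpleGraph V) (S : Set V) : Prop :=
  G.IsIndepSet S ∧ ∀ T : Set V, G.IsIndepSet T → diff G T ≤ diff G S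

/-- A critical independent set of maximum cardinality. -/
def IsMaximumCriticalIndepSet (G : SimpleGraph V) (S : Set V) : Prop :=
  IsCriticalIndepSet G S ∧ ∀ T : Set V, IsCriticalIndepSet G T → T.ncard ≤ S.ncard

/-- The intersection of all maximum critical independent sets. -/
def nucleus (G : SimpleGraph V) : Set V :=
  ⋂₀ {S | IsMaximumCriticalIndepSet G S}

/-- The union of all critical independent sets. -/
def diadem (G : SimpleGraph V) : Set V :=
  ⋃₀ {S | IsCriticalIndepSet G S}

/-- A matching of `G` with the largest number of edges. -/
def IsMaximumMatching (G : SimpleGraph V) (M : G.Subgraph) : Prop :=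
  M.IsMatching ∧ ∀ M' : G.Subgraph, M'.IsMatching → M'.edgeSet.ncard ≤ M.edgeSet.ncard

/-- The matching number `μ(G)`. -/
noncomputable def matchingNumber (G : SimpleGraph V) : ℕ :=
  sSup {n | ∃ M : G.Subgraph, M.IsMatching ∧ M.edgeSet.ncard = n}

/-- `α(G) + μ(G)` equals the order of `G`. -/
def IsKonigEgervary (G : SimpleGraph V) : Prop :=
  G.indepNum + matchingNumber G = Nat.card V

/-- The vertices missed by some maximum matching (a subgraph that is a matching has as its
vertices exactly the saturated ones). -/
def setD (G : SimpleGraph V) : Set V :=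
  {v | ∃ M : G.Subgraph, IsMaximumMatching G M ∧ v ∉ M.verts}

/-- The vertices outside `D(G)` with a neighbour in `D(G)`. -/
def setA (G : SimpleGraph V) : Set V :=
  {v | (∃ w ∈ setD G, G.Adj v w) ∧ v ∉ setD G}

/-- The vertices neither in `D(G)` nor in `A(G)`. -/
def setC (G : SimpleGraph V) : Set V :=
  (setD G ∪ setA G)ᶜ

/-- The set of isolated vertices of the induced subgraph `G[D(G)]`, as vertices of `G`. -/
def isolatedD (G : SimpleGraph V) : Set V :=
  Subtype.val '' {v : setD G | (G.induce (setD G)).IsIsolated v}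

/-- The subgraph `C` of `G` is a cycle of odd length. -/
def IsOddCycle (G : SimpleGraph V) (C : G.Subgraph) : Prop :=
  ∃ (v : V) (c : G.Walk v v), c.IsCycle ∧ Odd c.length ∧ c.toSubgraph = C

/-- `G` has exactly one odd cycle (cycles being subgraphs). -/
def IsAlmostBipartite (G : SimpleGraph V) : Prop :=
  ∃! C : G.Subgraph, IsOddCycle G C

/-- The closed walk `c` is an `M`-blossom with base `b`: a cycle of length `2k + 1` with
exactly `k` edges in `M`, none of which is incident with `b`. -/
def IsBlossom {G : SimpleGraph V} (M : G.Subgraph) {b : V} (c : G.Walk b b) : Prop :=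
  c.IsCycle ∧
  (∃ k : ℕ, c.length = 2 * k + 1 ∧ {e | e ∈ c.edges ∧ e ∈ M.edgeSet}.ncard = k) ∧
  ∀ e ∈ c.edges, e ∈ M.edgeSet → b ∉ e

/-- Of any two consecutive edges of `p`, exactly one belongs to `M`. -/
def IsAlternating {G : SimpleGraph V} (M : G.Subgraph) {x y : V} (p : G.Walk x y) : Prop :=
  p.edges.IsChain (fun e f => e ∈ M.edgeSet ↔ f ∉ M.edgeSet)

/-- The blossom `c` with base `b` and the stem `p` from `b` to the root `r` form
an `M`-flower. -/
def IsFlower {G : SimpleGraph V} (M : G.Subgraph) {b r : V} (c : G.Walk b b)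
    (p : G.Walk b r) : Prop :=
  IsBlossom M c ∧
  p.IsPath ∧ Even p.length ∧ IsAlternating M p ∧ r ∉ M.verts ∧
  ∀ v, v ∈ c.support → v ∈ p.support → v = b

/-- The reach set `R(C)`: the union of the vertex sets of all `M`-flowers with blossom `C`,
over all maximum matchings `M`. -/
def reachSet (G : SimpleGraph V) (C : G.Subgraph) : Set V :=
  {v | ∃ M : G.Subgraph, IsMaximumMatching G M ∧
    ∃ (b r : V) (c : G.Walk b b) (p : G.Walk b r),
      IsFlower M c p ∧ c.toSubgraph = C ∧ (v ∈ c.support ∨ v ∈ p.support)}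

/-- The vertices of `S` having a neighbour outside `S`. -/
def boundary (G : SimpleGraph V) (S : Set V) : Set V :=
  {v | v ∈ S ∧ ∃ w, w ∉ S ∧ G.Adj v w}

/-- `G` is a BAB-graph `(B, G₁, …, G_k)`. The map `part` records to which of the disjoint graphs
each vertex belongs (`none` for `B`, `some i` for `G_i`). As all added edges join different
parts, `B` and the `G_i` are the subgraphs of `G` induced by the parts. -/
def IsBAB (G : SimpleGraph V) : Prop :=
  ∃ (k : ℕ) (part : V → Option (Fin k)),
    let VB : Set V := {v | part v = none}
    let VG : Fin k → Set V := fun i => {v | part v = some i}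
    (G.induce VB).IsBipartite ∧
    boundary G VB ⊆ Subtype.val '' (setA (G.induce VB) ∪ setC (G.induce VB)) ∧
    ∀ i : Fin k,
      IsAlmostBipartite (G.induce (VG i)) ∧
      ¬ IsKonigEgervary (G.induce (VG i)) ∧
      (∀ C : (G.induce (VG i)).Subgraph, IsOddCycle (G.induce (VG i)) C →
        reachSet (G.induce (VG i)) C = Set.univ) ∧
      boundary G (VG i) ⊆ Subtype.val '' setA (G.induce (VG i))

end BABGraph

/-!
Cross edges never touch `D` of a piece, and adding edges outside `D` changes neither `D` nor the
fact that a matching is maximum; hence `D(G)` is the union of the sets `D` of the pieces. An edge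
inside `D` of a piece lies on an odd cycle (take the symmetric difference of two maximum matchings
missing its ends), so there is none in `B`, and in `G_i` all of them lie on the cycle `C_i`; since
flowers with blossom `C_i` exist, for each vertex of `C_i` some maximum matching of `G_i` matches
all the others within `C_i`.

Let `X` be the set of isolated vertices of `G[D(G)]`. Such matchings, which together match `A(G)`
into `X`, bound `d(S)` by `|X| - |A(G)|` for every independent `S`, and for each colour class `L` of
the bipartite graph `G[C(G)]` the set `X ∪ L` attains the bound. As `2|S| = |S ∪ N(S)| + d(S)`, a
critical independent set `S` is maximum iff `S ∪ N(S)` is the complement of the cycles `C_i`. For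
such `S` the map of every maximum matching sends `S ∩ A(G)` into `N(S) ∩ D(G)`, and that of the
matchings above also sends `N(S) ∩ D(G)` into `S ∩ A(G)`, so every maximum matching saturates
`N(S) ∩ D(G)`. But each vertex of `D(G)` is missed by some maximum matching; so `N(S) ∩ D(G) = ∅`
and `X ⊆ S`. The two colour classes of `G[C(G)]` give `(X ∪ L) ∩ (X ∪ R) = X`.
-/

namespace BABGraph

open Function Set

section MatchingMap

variable {V : Type*} {G : SimpleGraph V} {f g : V → V} {P : Set V}

/-- A matching of `G`, encoded as the involution that exchanges the two ends of each of its edges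
and fixes the vertices it misses. -/
structure IsMatchingMap (G : SimpleGraph V) (f : V → V) : Prop where
  involutive : Involutive f
  adj : ∀ v, f v ≠ v → G.Adj v (f v)

/-- A matching, encoded as an involution, that misses the least possible number of vertices. -/
structure IsMaximumMatchingMap (G : SimpleGraph V) (f : V → V) : Prop
    extends IsMatchingMap G f where
  ncard_le : ∀ g, IsMatchingMap G g → (fixedPoints f).ncard ≤ (fixedPoints g).ncard

theorem isMatchingMap_id (G : SimpleGraph V) : IsMatchingMap G id :=
  ⟨fun _ => rfl, fun _ h => (h rfl).elim⟩

theorem IsMatchingMap.mono {G' : SimpleGraph V} (hf : IsMatchingMap G' f) (h : G' ≤ G) :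
    IsMatchingMap G f :=
  ⟨hf.involutive, fun v hv => h (hf.adj v hv)⟩

theorem IsMaximumMatchingMap.of_ncard_le (hf : IsMaximumMatchingMap G f) (hg : IsMatchingMap G g)
    (h : (fixedPoints g).ncard ≤ (fixedPoints f).ncard) : IsMaximumMatchingMap G g :=
  ⟨hg, fun k hk => h.trans (hf.ncard_le k hk)⟩

theorem exists_isMaximumMatchingMap (G : SimpleGraph V) : ∃ f, IsMaximumMatchingMap G f := by
  have : Nonempty {f // IsMatchingMap G f} := ⟨id, isMatchingMap_id G⟩
  let missed : {f // IsMatchingMap G f} → ℕ := fun f => (fixedPoints f.1).ncard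
  obtain ⟨f, hf⟩ : ∃ f, ∀ g, missed f ≤ missed g := ⟨argmin missed, fun g => argmin_le missed g⟩
  exact ⟨f.1, f.2, fun g hg => hf ⟨g, hg⟩⟩

theorem two_mul_ncard_image_edge [Finite V] (hf : Involutive f) (hP : MapsTo f P P) :
    2 * ((fun v => s(v, f v)) '' (P \ fixedPoints f)).ncard = (P \ fixedPoints f).ncard := by
  classical
  have := Fintype.ofFinite V
  set T := (P \ fixedPoints f).toFinset with hT
  have himage : ((fun v => s(v, f v)) '' (P \ fixedPoints f)).ncard =
      (T.image fun v => s(v, f v)).card := by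
    rw [← Set.ncard_coe_finset, Finset.coe_image, coe_toFinset]
  rw [himage, ncard_eq_toFinset_card', ← hT,
    Finset.card_eq_sum_card_image (fun v => s(v, f v)) T, Finset.sum_const_nat (m := 2), mul_comm]
  intro e he
  obtain ⟨v, hv, rfl⟩ := Finset.mem_image.1 he
  rw [mem_toFinset] at hv
  have hfv : f v ∈ P \ fixedPoints f :=
    ⟨hP hv.1, fun h => hv.2 (by rw [mem_fixedPoints, IsFixedPt, hf] at h; exact h.symm)⟩
  have hfiber : (T.filter fun a => s(a, f a) = s(v, f v)) = {v, f v} := by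
    ext a
    simp only [hT, Finset.mem_filter, mem_toFinset, Finset.mem_insert, Finset.mem_singleton,
      Sym2.eq_iff]
    constructor
    · rintro ⟨-, h | h⟩ <;> simp [h.1]
    · rintro (rfl | rfl)
      · exact ⟨hv, Or.inl ⟨rfl, rfl⟩⟩
      · exact ⟨hfv, Or.inr ⟨rfl, hf v⟩⟩
  rw [hfiber, Finset.card_pair (Ne.symm hv.2)]

theorem even_ncard_sdiff_fixedPoints [Finite V] (hf : Involutive f) (hP : MapsTo f P P) :
    Even (P \ fixedPoints f).ncard :=
  ⟨_, (two_mul_ncard_image_edge hf hP).symm.trans (two_mul _)⟩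

section Piecewise

variable [∀ v, Decidable (v ∈ P)]

theorem IsMatchingMap.piecewise (hf : IsMatchingMap G f) (hg : IsMatchingMap G g)
    (hfP : MapsTo f P P) (hgP : MapsTo g P P) : IsMatchingMap G (P.piecewise g f) := by
  have hfP' : ∀ v ∉ P, f v ∉ P := fun v hv h => hv (hf.involutive v ▸ hfP h)
  refine ⟨fun v => ?_, fun v => ?_⟩ <;> by_cases hv : v ∈ P
  · rw [piecewise_eq_of_mem _ _ _ hv, piecewise_eq_of_mem _ _ _ (hgP hv), hg.involutive]
  · rw [piecewise_eq_of_notMem _ _ _ hv, piecewise_eq_of_notMem _ _ _ (hfP' v hv), hf.involutive]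
  · rw [piecewise_eq_of_mem _ _ _ hv]
    exact hg.adj v
  · rw [piecewise_eq_of_notMem _ _ _ hv]
    exact hf.adj v

theorem fixedPoints_piecewise (f g : V → V) :
    fixedPoints (P.piecewise g f) = P.ite (fixedPoints g) (fixedPoints f) := by
  ext v
  by_cases hv : v ∈ P <;> simp [IsFixedPt, Set.ite, hv]

theorem ncard_fixedPoints_piecewise [Finite V] (f g : V → V) :
    (fixedPoints (P.piecewise g f)).ncard =
      (fixedPoints g ∩ P).ncard + (fixedPoints f \ P).ncard := by
  rw [fixedPoints_piecewise, Set.ite,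
    ncard_union_eq (disjoint_sdiff_right.mono_left inter_subset_right)]

end Piecewise

/-- The involution `f` exchanges the ends of each edge of the matching `M` and fixes the other
vertices. -/
structure Encodes (f : V → V) (M : G.Subgraph) : Prop where
  isMatching : M.IsMatching
  adj_iff : ∀ v w, M.Adj v w ↔ f v = w ∧ v ≠ w

theorem exists_encodes {M : G.Subgraph} (hM : M.IsMatching) : ∃ f : V → V, Encodes f M := by
  have hpartner : ∀ v, ∃ v', (∀ w, M.Adj v w → v' = w) ∧ (v' ≠ v → M.Adj v v') := by
    intro v
    by_cases hv : v ∈ M.verts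
    · obtain ⟨w, hw, hunique⟩ := hM hv
      exact ⟨w, fun x hx => (hunique x hx).symm, fun _ => hw⟩
    · exact ⟨v, fun w hw => (hv (M.edge_vert hw)).elim, fun h => (h rfl).elim⟩
  choose f heq hadj using hpartner
  refine ⟨f, hM, fun v w => ⟨fun h => ⟨heq v w h, h.ne⟩, ?_⟩⟩
  rintro ⟨rfl, hne⟩
  exact hadj v hne.symm

theorem IsMatchingMap.exists_encodes (hf : IsMatchingMap G f) :
    ∃ M : G.Subgraph, Encodes f M := by
  refine ⟨{ verts := (fixedPoints f)ᶜ, Adj := fun v w => f v = w ∧ v ≠ w, adj_sub := ?_,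
            edge_vert := ?_, symm := ⟨?_⟩ }, fun v hv => ?_, fun _ _ => Iff.rfl⟩
  · rintro v w ⟨rfl, h⟩
    exact hf.adj v h.symm
  · rintro v w ⟨rfl, h⟩
    exact h.symm
  · rintro v w ⟨rfl, h⟩
    exact ⟨hf.involutive v, h.symm⟩
  · exact ⟨f v, ⟨rfl, Ne.symm hv⟩, fun w hw => hw.1.symm⟩

namespace Encodes

variable {M : G.Subgraph}

theorem adj_apply (h : Encodes f M) {v : V} (hv : f v ≠ v) : M.Adj v (f v) :=
  (h.adj_iff v (f v)).2 ⟨rfl, hv.symm⟩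

theorem isMatchingMap (h : Encodes f M) : IsMatchingMap G f := by
  refine ⟨fun v => ?_, fun v hv => (h.adj_apply hv).adj_sub⟩
  by_cases hv : f v = v
  · rw [hv, hv]
  · exact ((h.adj_iff _ _).1 (h.adj_apply hv).symm).1

theorem mem_verts_iff (h : Encodes f M) {v : V} : v ∈ M.verts ↔ f v ≠ v := by
  refine ⟨fun hv => ?_, fun hv => M.edge_vert (h.adj_apply hv)⟩
  obtain ⟨w, hw, -⟩ := h.isMatching hv
  obtain ⟨rfl, hne⟩ := (h.adj_iff v w).1 hw
  exact hne.symm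

theorem edgeSet_eq (h : Encodes f M) :
    M.edgeSet = (fun v => s(v, f v)) '' (univ \ fixedPoints f) := by
  ext e
  induction e with | _ v w
  simp only [SimpleGraph.Subgraph.mem_edgeSet, mem_image, mem_sdiff, mem_univ, true_and,
    mem_fixedPoints, IsFixedPt, Sym2.eq_iff]
  constructor
  · intro hvw
    obtain ⟨rfl, hne⟩ := (h.adj_iff v w).1 hvw
    exact ⟨v, hne.symm, Or.inl ⟨rfl, rfl⟩⟩
  · rintro ⟨a, ha, ⟨rfl, rfl⟩ | ⟨rfl, rfl⟩⟩
    · exact h.adj_apply ha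
    · exact (h.adj_apply ha).symm

theorem two_mul_ncard_edgeSet_add [Finite V] (h : Encodes f M) :
    2 * M.edgeSet.ncard + (fixedPoints f).ncard = Nat.card V := by
  rw [h.edgeSet_eq, two_mul_ncard_image_edge h.isMatchingMap.involutive (mapsTo_univ f univ),
    ← compl_eq_univ_sdiff, add_comm, ncard_add_ncard_compl]

theorem isMaximumMatching_iff [Finite V] (h : Encodes f M) :
    IsMaximumMatching G M ↔ IsMaximumMatchingMap G f := by
  have hcard := h.two_mul_ncard_edgeSet_add
  refine ⟨fun hmax => ⟨h.isMatchingMap, fun g hg => ?_⟩,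
    fun hmax => ⟨h.isMatching, fun M' hM' => ?_⟩⟩
  · obtain ⟨M', h'⟩ := hg.exists_encodes
    have := hmax.2 M' h'.isMatching
    have := h'.two_mul_ncard_edgeSet_add
    lia
  · obtain ⟨g, h'⟩ := BABGraph.exists_encodes hM'
    have := hmax.ncard_le g h'.isMatchingMap
    have := h'.two_mul_ncard_edgeSet_add
    lia

end Encodes

theorem mem_setD_iff [Finite V] {v : V} :
    v ∈ setD G ↔ ∃ f, IsMaximumMatchingMap G f ∧ f v = v := by
  constructor
  · rintro ⟨M, hM, hv⟩
    obtain ⟨f, h⟩ := exists_encodes hM.1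
    exact ⟨f, h.isMaximumMatching_iff.1 hM, by rwa [h.mem_verts_iff, not_not] at hv⟩
  · rintro ⟨f, hf, hv⟩
    obtain ⟨M, h⟩ := hf.exists_encodes
    exact ⟨M, h.isMaximumMatching_iff.2 hf, by rwa [h.mem_verts_iff, not_not]⟩

theorem IsMaximumMatchingMap.mem_setD [Finite V] (hf : IsMaximumMatchingMap G f) {v : V}
    (hv : f v = v) : v ∈ setD G :=
  mem_setD_iff.2 ⟨f, hf, hv⟩

theorem IsMatchingMap.exists_join (hf : IsMatchingMap G f) {a b : V} (ha : f a = a)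
    (hb : f b = b) (hab : G.Adj a b) :
    ∃ g, IsMatchingMap G g ∧ fixedPoints g = fixedPoints f \ {a, b} ∧
      ∀ v, v ∉ ({a, b} : Set V) → g v = f v := by
  classical
  have hswap : IsMatchingMap G (Equiv.swap a b) := by
    refine ⟨Equiv.swap_apply_self a b, fun v hv => ?_⟩
    obtain ⟨-, rfl | rfl⟩ := Equiv.swap_apply_ne_self_iff.1 hv
    · rwa [Equiv.swap_apply_left]
    · rw [Equiv.swap_apply_right]
      exact hab.symm
  refine ⟨_, hf.piecewise hswap (P := {a, b}) ?_ ?_, ?_,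
    fun v hv => piecewise_eq_of_notMem _ _ _ hv⟩
  · rintro v (rfl | rfl) <;> simp [ha, hb]
  · rintro v (rfl | rfl) <;> simp
  · rw [fixedPoints_piecewise, Set.ite, union_eq_right]
    rintro v ⟨hv, rfl | rfl⟩ <;> simp [IsFixedPt, hab.ne, hab.ne.symm] at hv

theorem IsMatchingMap.exists_unjoin (hf : IsMatchingMap G f) (a : V) :
    ∃ g, IsMatchingMap G g ∧ fixedPoints g = {a, f a} ∪ fixedPoints f ∧
      ∀ v, v ∉ ({a, f a} : Set V) → g v = f v := by
  classical
  refine ⟨_, hf.piecewise (isMatchingMap_id G) (P := {a, f a}) ?_ (mapsTo_id _), ?_,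
    fun v hv => piecewise_eq_of_notMem _ _ _ hv⟩
  · rintro v (rfl | rfl) <;> simp [hf.involutive _]
  · rw [fixedPoints_piecewise, Set.ite, fixedPoints_id, univ_inter, union_sdiff_self]

theorem ncard_pair_union_le (a b : V) (S : Set V) : ({a, b} ∪ S).ncard ≤ S.ncard + 2 := by
  rw [insert_union, singleton_union]
  exact (ncard_insert_le _ _).trans (Nat.add_le_add_right (ncard_insert_le _ _) 1)

theorem IsMaximumMatchingMap.not_adj [Finite V] (hf : IsMaximumMatchingMap G f) {a b : V}
    (ha : f a = a) (hb : f b = b) : ¬ G.Adj a b := by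
  intro h
  obtain ⟨g, hg, hfix, -⟩ := hf.exists_join ha hb h
  refine (hf.ncard_le g hg).not_gt (ncard_lt_ncard ⟨hfix ▸ sdiff_subset, fun hsub => ?_⟩)
  have ha' := hsub (show a ∈ fixedPoints f from ha)
  rw [hfix] at ha'
  exact ha'.2 (mem_insert a {b})

theorem IsMaximumMatchingMap.exists_rotate [Finite V] (hf : IsMaximumMatchingMap G f) {y z : V}
    (hz : f z = z) (hyz : G.Adj y z) :
    ∃ g, IsMaximumMatchingMap G g ∧ g (f y) = f y ∧
      ∀ v, v ∉ ({y, z, f y} : Set V) → g v = f v := by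
  have hy : f y ≠ y := fun h => hf.not_adj h hz hyz
  have hzy : z ≠ f y := fun h => hyz.ne (by rw [← hf.involutive y, ← h, hz])
  obtain ⟨f₁, hf₁, hfix₁, hoff₁⟩ := hf.exists_unjoin y
  have hmem₁ : ∀ {v}, v ∈ ({y, f y} ∪ fixedPoints f : Set V) → f₁ v = v := fun hv => by
    rwa [← hfix₁] at hv
  obtain ⟨g, hg, hfix, hoff⟩ := hf₁.exists_join (hmem₁ (by simp)) (hmem₁ (Or.inr hz)) hyz
  have hfix' : fixedPoints g = insert (f y) (fixedPoints f \ {z}) := by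
    ext v
    have hyfix : y ∉ fixedPoints f := hy
    simp only [hfix, hfix₁, mem_sdiff, mem_union, mem_insert_iff, mem_singleton_iff]
    grind
  refine ⟨g, hf.of_ncard_le hg ?_, ?_, fun v hv => ?_⟩
  · rw [hfix']
    exact (ncard_insert_le _ _).trans (ncard_sdiff_singleton_add_one (mem_fixedPoints.2 hz)).le
  · exact hfix'.symm.subset (mem_insert _ _)
  · simp only [mem_insert_iff, mem_singleton_iff, not_or] at hv
    rw [hoff v (by simp [hv]), hoff₁ v (by simp [hv])]

end MatchingMap

section UnionGraph

variable {V : Type*} {G : SimpleGraph V} {f g : V → V}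

/-- The graph whose edges are those of the two matchings encoded by the involutions `f` and `g`. -/
def unionGraph (f g : V → V) : SimpleGraph V :=
  SimpleGraph.fromRel fun v w => f v = w ∨ g v = w

theorem unionGraph_adj_iff (hf : Involutive f) (hg : Involutive g) {v w : V} :
    (unionGraph f g).Adj v w ↔ v ≠ w ∧ (f v = w ∨ g v = w) := by
  rw [unionGraph, SimpleGraph.fromRel_adj, hf.eq_iff (x := w), hg.eq_iff (x := w), eq_comm (a := w),
    eq_comm (a := w), or_self]

theorem unionGraph_le (hf : IsMatchingMap G f) (hg : IsMatchingMap G g) : unionGraph f g ≤ G := by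
  intro v w h
  obtain ⟨hne, rfl | rfl⟩ := (unionGraph_adj_iff hf.involutive hg.involutive).1 h
  · exact hf.adj v hne.symm
  · exact hg.adj v hne.symm

section Component

variable (C : (unionGraph f g).ConnectedComponent)

theorem mapsTo_supp_left : MapsTo f C.supp C.supp := by
  intro v hv
  by_cases h : f v = v
  · rwa [h]
  · exact C.mem_supp_of_adj_mem_supp hv ⟨Ne.symm h, Or.inl (Or.inl rfl)⟩

theorem mapsTo_supp_right : MapsTo g C.supp C.supp := by
  intro v hv
  by_cases h : g v = v
  · rwa [h]
  · exact C.mem_supp_of_adj_mem_supp hv ⟨Ne.symm h, Or.inl (Or.inr rfl)⟩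

theorem card_edgeSet_toSimpleGraph_le [Finite V] (hf : Involutive f) (hg : Involutive g) :
    Nat.card C.toSimpleGraph.edgeSet ≤
      ((fun v => s(v, f v)) '' (C.supp \ fixedPoints f)).ncard +
        ((fun v => s(v, g v)) '' (C.supp \ fixedPoints g)).ncard := by
  refine le_trans ?_ (ncard_union_le _ _)
  rw [Nat.card_coe_set_eq]
  refine ncard_le_ncard_of_injOn (Sym2.map Subtype.val) ?_
    (Sym2.map.injective Subtype.val_injective).injOn (toFinite _)
  intro e he
  induction e with | _ x y
  obtain ⟨hne, h | h⟩ := (unionGraph_adj_iff hf hg).1 (SimpleGraph.induce_adj.1 he)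
  · exact Or.inl ⟨x, ⟨x.2, fun hx => hne (hx.symm.trans h)⟩, by simp [h]⟩
  · exact Or.inr ⟨x, ⟨x.2, fun hx => hne (hx.symm.trans h)⟩, by simp [h]⟩

theorem ncard_fixedPoints_inter_supp_add_le [Finite V] (hf : Involutive f) (hg : Involutive g) :
    (fixedPoints f ∩ C.supp).ncard + (fixedPoints g ∩ C.supp).ncard ≤ 2 := by
  have hconnected := C.connected_toSimpleGraph.card_vert_le_card_edgeSet_add_one
  have hedges := card_edgeSet_toSimpleGraph_le C hf hg
  have hf_edges := two_mul_ncard_image_edge hf (mapsTo_supp_left C)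
  have hg_edges := two_mul_ncard_image_edge hg (mapsTo_supp_right C)
  have hf_split := ncard_inter_add_ncard_sdiff_eq_ncard C.supp (fixedPoints f)
  have hg_split := ncard_inter_add_ncard_sdiff_eq_ncard C.supp (fixedPoints g)
  rw [inter_comm] at hf_split hg_split
  have hverts : Nat.card C = C.supp.ncard := Nat.card_coe_set_eq _
  lia

end Component

theorem parity_length_of_isPath_unionGraph (hf : Involutive f) (hg : Involutive g) {x v : V}
    (p : (unionGraph f g).Walk x v) (hp : p.IsPath) (hv : g v = v) :
    (f x ∉ p.support.tail → Even p.length) ∧ (g x ∉ p.support → Odd p.length) := by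
  induction p with
  | nil => exact ⟨fun _ => by simp, fun h => by simp [hv] at h⟩
  | @cons x y v h p ih =>
    rw [SimpleGraph.Walk.cons_isPath_iff] at hp
    obtain ⟨hodd, heven⟩ := ih hp.1 hv
    rw [SimpleGraph.Walk.length_cons, SimpleGraph.Walk.support_cons, List.tail_cons]
    obtain ⟨-, rfl | rfl⟩ := (unionGraph_adj_iff hf hg).1 h
    · refine ⟨fun h => (h p.start_mem_support).elim, fun _ => (hodd ?_).add_one⟩
      rw [hf]
      exact fun h => hp.2 (List.mem_of_mem_tail h)
    · refine ⟨fun _ => (heven ?_).add_one, fun h => (h (by simp)).elim⟩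
      rw [hg]
      exact hp.2

end UnionGraph

section Exchange

variable {V : Type*} [Finite V] {G : SimpleGraph V} {f g : V → V} {u v : V}

theorem exists_isCycle_odd_length_of_adj (hu : u ∈ setD G) (hv : v ∈ setD G) (huv : G.Adj u v) :
    ∃ c : G.Walk v v, c.IsCycle ∧ Odd c.length := by
  classical
  obtain ⟨f, hf, hfu⟩ := mem_setD_iff.1 hu
  obtain ⟨g, hg, hgv⟩ := mem_setD_iff.1 hv
  set C := (unionGraph f g).connectedComponentMk u
  have huC : u ∈ C.supp := SimpleGraph.ConnectedComponent.connectedComponentMk_mem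
  have hreach : v ∈ C.supp := by
    by_contra hvC
    have hswap := hf.ncard_le _ (hf.piecewise hg.toIsMatchingMap (mapsTo_supp_left C)
      (mapsTo_supp_right C))
    have hswap' := hg.piecewise hf.toIsMatchingMap (mapsTo_supp_right C) (mapsTo_supp_left C)
    have hmax : IsMaximumMatchingMap G (C.supp.piecewise f g) := by
      refine hg.of_ncard_le hswap' ?_
      rw [ncard_fixedPoints_piecewise] at hswap ⊢
      have := ncard_inter_add_ncard_sdiff_eq_ncard (fixedPoints f) C.supp
      have := ncard_inter_add_ncard_sdiff_eq_ncard (fixedPoints g) C.supp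
      lia
    refine hmax.not_adj (a := u) (b := v) ?_ ?_ huv
    · rwa [piecewise_eq_of_mem _ _ _ huC]
    · rwa [piecewise_eq_of_notMem _ _ _ hvC]
  obtain ⟨p, hp⟩ := (SimpleGraph.ConnectedComponent.exact hreach).symm.exists_isPath
  have hfu' : f u ∉ p.support.tail := by
    rw [hfu]
    exact fun h => (List.nodup_cons.1 (p.cons_tail_support.symm ▸ hp.support_nodup)).1 h
  have heven := (parity_length_of_isPath_unionGraph hf.involutive hg.involutive p hp hgv).1 hfu'
  refine ⟨.cons huv.symm (p.mapLe (unionGraph_le hf.toIsMatchingMap hg.toIsMatchingMap)), ?_, ?_⟩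
  · rw [SimpleGraph.Walk.cons_isCycle_iff, SimpleGraph.Walk.edges_mapLe_eq_edges]
    refine ⟨(SimpleGraph.Walk.isPath_mapLe _).2 hp, fun he => ?_⟩
    obtain ⟨hne, h | h⟩ :=
      (unionGraph_adj_iff hf.involutive hg.involutive).1 (p.adj_of_mem_edges he)
    · exact hne (by rw [← hfu, ← h, hf.involutive])
    · exact hne (hgv.symm.trans h)
  · simpa using heven.add_one

theorem IsMaximumMatchingMap.exists_fixedPoints_inter_eq_pair (hf : IsMaximumMatchingMap G f)
    (hg : IsMatchingMap G g) (hcard : (fixedPoints g).ncard ≤ (fixedPoints f).ncard + 2)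
    (huv : u ≠ v) (hgu : g u = u) (hgv : g v = v) (hu : u ∉ setD G) (hv : v ∉ setD G) :
    ∃ P : Set V, MapsTo f P P ∧ MapsTo g P P ∧
      fixedPoints f ∩ P = ∅ ∧ fixedPoints g ∩ P = {u, v} := by
  classical
  set C := (unionGraph f g).connectedComponentMk u
  have hfC := mapsTo_supp_left C
  have hgC := mapsTo_supp_right C
  have huC : u ∈ C.supp := SimpleGraph.ConnectedComponent.connectedComponentMk_mem
  have hends := ncard_fixedPoints_inter_supp_add_le C hf.involutive hg.involutive
  have hf_split := ncard_inter_add_ncard_sdiff_eq_ncard (fixedPoints f) C.supp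
  have hg_split := ncard_inter_add_ncard_sdiff_eq_ncard (fixedPoints g) C.supp
  have hlt : (fixedPoints f ∩ C.supp).ncard < (fixedPoints g ∩ C.supp).ncard := by
    by_contra! hle
    have hmax := hf.of_ncard_le (hf.piecewise hg hfC hgC) (by
      rw [ncard_fixedPoints_piecewise]
      lia)
    exact hu (hmax.mem_setD ((piecewise_eq_of_mem _ _ _ huC).trans hgu))
  have hparity : (fixedPoints f ∩ C.supp).ncard = 0 ∧ (fixedPoints g ∩ C.supp).ncard = 2 := by
    obtain ⟨m, hm⟩ := even_ncard_sdiff_fixedPoints hf.involutive hfC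
    obtain ⟨n, hn⟩ := even_ncard_sdiff_fixedPoints hg.involutive hgC
    have hf_supp := ncard_inter_add_ncard_sdiff_eq_ncard C.supp (fixedPoints f)
    have hg_supp := ncard_inter_add_ncard_sdiff_eq_ncard C.supp (fixedPoints g)
    rw [inter_comm] at hf_supp hg_supp
    lia
  have hvC : v ∈ C.supp := by
    by_contra hvC
    have hmax := hf.of_ncard_le (hg.piecewise hf.toIsMatchingMap hgC hfC) (by
      rw [ncard_fixedPoints_piecewise]
      lia)
    exact hv (hmax.mem_setD ((piecewise_eq_of_notMem _ _ _ hvC).trans hgv))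
  refine ⟨C.supp, hfC, hgC, (ncard_eq_zero).1 hparity.1, (eq_of_subset_of_ncard_le ?_ ?_).symm⟩
  · rintro w (rfl | rfl)
    exacts [⟨hgu, huC⟩, ⟨hgv, hvC⟩]
  · rw [hparity.2, ncard_pair huv]

theorem IsMaximumMatchingMap.mem_setD_of_mem_setA (hf : IsMaximumMatchingMap G f) {a : V}
    (ha : a ∈ setA G) : f a ∈ setD G := by
  classical
  obtain ⟨⟨w, hw, haw⟩, haD⟩ := ha
  obtain ⟨g, hg, hgw⟩ := mem_setD_iff.1 hw
  by_contra hfa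
  obtain ⟨f', hf', hfix', -⟩ := hf.exists_unjoin a
  have hmiss' : ∀ v ∈ ({a, f a} : Set V), f' v = v := fun v hv =>
    hfix'.symm.subset (Or.inl hv)
  have hcard : (fixedPoints f').ncard ≤ (fixedPoints g).ncard + 2 := by
    rw [hfix']
    exact (ncard_pair_union_le _ _ _).trans
      (Nat.add_le_add_right (hf.ncard_le g hg.toIsMatchingMap) 2)
  obtain ⟨P, hgP, hfP, hgPfix, hfPfix⟩ := hg.exists_fixedPoints_inter_eq_pair hf' hcard
    (fun h => haD (hf.mem_setD h.symm)) (hmiss' a (by simp)) (hmiss' (f a) (by simp)) haD hfa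
  have hswap := hg.piecewise hf' hgP hfP
  have hswapfix : fixedPoints (P.piecewise f' g) = {a, f a} ∪ fixedPoints g := by
    rw [fixedPoints_piecewise, Set.ite, hfPfix, ← sdiff_self_inter, hgPfix, sdiff_empty]
  obtain ⟨h, hh, hhfix, -⟩ := hswap.exists_join (a := a) (b := w)
    (hswapfix.symm.subset (by simp)) (hswapfix.symm.subset (Or.inr hgw)) haw
  have hsub : fixedPoints h ⊆ insert (f a) (fixedPoints g \ {w}) := by
    rw [hhfix, hswapfix]
    grind
  have hmax := hg.of_ncard_le hh <| (ncard_le_ncard hsub).trans <| (ncard_insert_le _ _).trans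
    (ncard_sdiff_singleton_add_one (mem_fixedPoints.2 hgw)).le
  refine hfa (hmax.mem_setD (hhfix.symm.subset ⟨hswapfix.symm.subset (by simp), ?_⟩))
  rintro (h | h)
  · exact haD (hf.mem_setD h)
  · exact hfa (h ▸ hw)

end Exchange

section Stability

variable {V : Type*} [Finite V] {G G' : SimpleGraph V} {f g : V → V} {a b : V}

theorem IsMaximumMatchingMap.exists_fixedPoints_eq_of_sup_edge (hf : IsMaximumMatchingMap G f)
    (ha : a ∉ setD G) (hb : b ∉ setD G) (hg : IsMatchingMap (G ⊔ SimpleGraph.edge a b) g)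
    (hcard : (fixedPoints g).ncard ≤ (fixedPoints f).ncard) :
    ∃ k, IsMatchingMap G k ∧ fixedPoints k = fixedPoints g := by
  classical
  have hedge : ∀ {v w}, (G ⊔ SimpleGraph.edge a b).Adj v w →
      G.Adj v w ∨ (v = a ∧ w = b ∨ v = b ∧ w = a) := fun h =>
    h.imp_right fun h => (SimpleGraph.edge_adj ..).1 h |>.1
  by_cases hab : g a = b ∧ a ≠ b
  · obtain ⟨rfl, hne⟩ := hab
    obtain ⟨g', hg', hfix, -⟩ := hg.exists_unjoin a
    have hmiss : ∀ v ∈ ({a, g a} : Set V), g' v = v := fun v hv => hfix.symm.subset (Or.inl hv)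
    have hgG : IsMatchingMap G g' := by
      refine ⟨hg'.involutive, fun v hv => (hedge (hg'.adj v hv)).resolve_right ?_⟩
      rintro (⟨rfl, -⟩ | ⟨rfl, -⟩) <;> exact hv (hmiss _ (by simp))
    have hcard' : (fixedPoints g').ncard ≤ (fixedPoints f).ncard + 2 := by
      rw [hfix]
      exact (ncard_pair_union_le _ _ _).trans (Nat.add_le_add_right hcard 2)
    obtain ⟨P, hfP, hgP, hfPfix, hgPfix⟩ := hf.exists_fixedPoints_inter_eq_pair hgG hcard' hne
      (hmiss a (by simp)) (hmiss _ (by simp)) ha hb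
    refine ⟨P.piecewise f g', hgG.piecewise hf.toIsMatchingMap hgP hfP, ?_⟩
    rw [fixedPoints_piecewise, Set.ite, hfPfix, ← sdiff_self_inter, hgPfix, hfix,
      empty_union, union_sdiff_left, sdiff_eq_left, disjoint_right]
    rintro v (rfl | rfl) hv
    · exact hne hv.symm
    · exact hne (hg.involutive.injective hv).symm
  · refine ⟨g, ⟨hg.involutive, fun v hv => (hedge (hg.adj v hv)).resolve_right ?_⟩, rfl⟩
    rintro (⟨rfl, h⟩ | ⟨rfl, h⟩)
    · exact hab ⟨h, fun hvb => hv (h.trans hvb.symm)⟩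
    · exact hab ⟨by rw [← h, hg.involutive], fun hav => hv (h.trans hav)⟩

theorem IsMaximumMatchingMap.sup_edge (hf : IsMaximumMatchingMap G f) (ha : a ∉ setD G)
    (hb : b ∉ setD G) : IsMaximumMatchingMap (G ⊔ SimpleGraph.edge a b) f := by
  refine ⟨hf.toIsMatchingMap.mono le_sup_left, fun g hg => ?_⟩
  by_contra! hlt
  obtain ⟨k, hk, hkfix⟩ := hf.exists_fixedPoints_eq_of_sup_edge ha hb hg hlt.le
  exact (hf.ncard_le k hk).not_gt (hkfix ▸ hlt)

theorem setD_sup_edge (ha : a ∉ setD G) (hb : b ∉ setD G) :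
    setD (G ⊔ SimpleGraph.edge a b) = setD G := by
  ext v
  constructor <;> intro hv <;> obtain ⟨g, hg, hgv⟩ := mem_setD_iff.1 hv
  · obtain ⟨f, hf⟩ := exists_isMaximumMatchingMap G
    have hle := hg.ncard_le f (hf.sup_edge ha hb).toIsMatchingMap
    obtain ⟨k, hk, hkfix⟩ :=
      hf.exists_fixedPoints_eq_of_sup_edge ha hb hg.toIsMatchingMap hle
    exact (hf.of_ncard_le hk (hkfix ▸ hle)).mem_setD (hkfix.symm.subset hgv)
  · exact (hg.sup_edge ha hb).mem_setD hgv

theorem setD_eq_and_isMaximumMatchingMap_of_le (hle : G' ≤ G)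
    (hadj : ∀ u ∈ setD G', ∀ v, G.Adj u v → G'.Adj u v) :
    setD G = setD G' ∧ ∀ f, IsMaximumMatchingMap G' f → IsMaximumMatchingMap G f := by
  induction G' using WellFoundedGT.induction with | _ G' ih
  obtain rfl | hne := eq_or_ne G' G
  · exact ⟨rfl, fun f hf => hf⟩
  obtain ⟨a, b, hab, hab'⟩ : ∃ a b, G.Adj a b ∧ ¬ G'.Adj a b := by
    by_contra! h
    exact hne (hle.antisymm fun a b => h a b)
  have ha : a ∉ setD G' := fun h => hab' (hadj a h b hab)
  have hb : b ∉ setD G' := fun h => hab' (hadj b h a hab.symm).symm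
  have hlt : G' < G' ⊔ SimpleGraph.edge a b :=
    le_sup_left.lt_of_not_ge fun h => hab' (h (Or.inr (by simp [SimpleGraph.edge_adj, hab.ne])))
  obtain ⟨hD, hmax⟩ := ih _ hlt (sup_le hle ((SimpleGraph.edge_le_iff G).2 (Or.inr hab)))
    fun u hu v huv => Or.inl (hadj u (setD_sup_edge ha hb ▸ hu) v huv)
  exact ⟨hD.trans (setD_sup_edge ha hb), fun f hf => hmax f (hf.sup_edge ha hb)⟩

end Stability

section Flower

variable {V : Type*} {G : SimpleGraph V} {M : G.Subgraph} {f : V → V} {b r w x y : V}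

/-- The involution `f` maps `S` to itself, and `w` is its only fixed point in `S`: the matching
encoded by `f` restricts to a perfect matching of `S \ {w}`. -/
structure IsNearPerfectOn (f : V → V) (S : Set V) (w : V) : Prop where
  mapsTo : MapsTo f S S
  fixedPoints_inter : fixedPoints f ∩ S = {w}

theorem IsNearPerfectOn.apply_eq {S : Set V} (h : IsNearPerfectOn f S w) : f w = w :=
  (h.fixedPoints_inter.symm.subset rfl).1

theorem IsNearPerfectOn.eq_of_apply_eq {S : Set V} (h : IsNearPerfectOn f S w) (hx : x ∈ S)
    (hfx : f x = x) : x = w :=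
  h.fixedPoints_inter.subset ⟨hfx, hx⟩

theorem IsMaximumMatchingMap.of_isNearPerfectOn [Finite V] {g : V → V} {S : Set V}
    (hf : IsMaximumMatchingMap G f) (hg : IsMatchingMap G g) (hfS : IsNearPerfectOn f S b)
    (hgS : IsNearPerfectOn g S w) :
    ∃ h, IsMaximumMatchingMap G h ∧ IsNearPerfectOn h S w := by
  classical
  refine ⟨S.piecewise g f, hf.of_ncard_le (hf.piecewise hg hfS.mapsTo hgS.mapsTo) ?_,
    fun v hv => ?_, ?_⟩
  · rw [ncard_fixedPoints_piecewise, hgS.fixedPoints_inter, ncard_singleton,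
      ← ncard_inter_add_ncard_sdiff_eq_ncard (fixedPoints f) S, hfS.fixedPoints_inter,
      ncard_singleton]
  · rw [piecewise_eq_of_mem _ _ _ hv]
    exact hgS.mapsTo hv
  · rw [fixedPoints_piecewise, ite_inter_self, hgS.fixedPoints_inter]

theorem IsAlternating.of_cons {h : G.Adj x y} {p : G.Walk y r}
    (hp : IsAlternating M (.cons h p)) : IsAlternating M p :=
  List.IsChain.tail hp

theorem IsAlternating.mem_edgeSet_iff_odd {h : G.Adj x y} {p : G.Walk y r}
    (hp : IsAlternating M (.cons h p)) (hr : r ∉ M.verts) : s(x, y) ∈ M.edgeSet ↔ Odd p.length := by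
  induction p generalizing x with
  | nil => simpa using fun h : M.Adj x _ => hr (M.edge_vert h.symm)
  | cons h' q ih =>
    have hfirst : s(x, _) ∈ M.edgeSet ↔ s(_, _) ∉ M.edgeSet := (List.isChain_cons_cons.1 hp).1
    rw [hfirst, ih hp.of_cons hr, SimpleGraph.Walk.length_cons, Nat.odd_add_one]

theorem IsAlternating.exists_isMaximumMatchingMap [Finite V] (hf : IsMaximumMatchingMap G f)
    (hM : Encodes f M) (hr : r ∉ M.verts) :
    ∀ {x : V} (p : G.Walk x r), p.IsPath → Even p.length → IsAlternating M p →
      ∃ g, IsMaximumMatchingMap G g ∧ g x = x ∧ ∀ v ∉ p.support, g v = f v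
  | _, .nil, _, _, _ => ⟨f, hf, by rwa [hM.mem_verts_iff, not_not] at hr, fun _ _ => rfl⟩
  | _, .cons _ .nil, _, heven, _ => by simp at heven
  | x, .cons (v := y) hxy (.cons (v := z) hyz q), hpath, heven, halt => by
    simp only [SimpleGraph.Walk.cons_isPath_iff, SimpleGraph.Walk.support_cons, List.mem_cons,
      not_or] at hpath
    obtain ⟨⟨hq, -⟩, -, hxq⟩ := hpath
    simp only [SimpleGraph.Walk.length_cons, Nat.even_add_one, not_not] at heven
    obtain ⟨f', hf', hz, hoff⟩ :=
      IsAlternating.exists_isMaximumMatchingMap hf hM hr q hq heven halt.of_cons.of_cons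
    have hxyM : s(x, y) ∈ M.edgeSet := (halt.mem_edgeSet_iff_odd hr).2 heven.add_one
    have hf'x : f' x = y := (hoff x hxq).trans ((hM.adj_iff x y).1 hxyM).1
    have hf'y : f' y = x := hf'x ▸ hf'.involutive x
    obtain ⟨g, hg, hgx, hgoff⟩ := hf'.exists_rotate hz hyz
    rw [hf'y] at hgx hgoff
    refine ⟨g, hg, hgx, fun v hv => ?_⟩
    simp only [SimpleGraph.Walk.support_cons, List.mem_cons, not_or] at hv
    have hvz : v ≠ z := fun h => hv.2.2 (h ▸ q.start_mem_support)
    rw [hgoff v (by simp [hv, hvz]), hoff v hv.2.2]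

theorem IsAlternating.mem_setD_or_adj [Finite V] (hf : IsMaximumMatchingMap G f)
    (hM : Encodes f M) (hr : r ∉ M.verts) {p : G.Walk x r} (hpath : p.IsPath)
    (halt : IsAlternating M p) {v : V} (hv : v ∈ p.support) :
    v ∈ setD G ∨ ∃ w ∈ setD G, G.Adj v w := by
  have hstart {x : V} (p : G.Walk x r) (hp : p.IsPath) (heven : Even p.length)
      (halt : IsAlternating M p) : x ∈ setD G := by
    obtain ⟨g, hg, hgx, -⟩ := IsAlternating.exists_isMaximumMatchingMap hf hM hr p hp heven halt
    exact hg.mem_setD hgx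
  induction p with
  | nil =>
    obtain rfl := List.mem_singleton.1 hv
    exact Or.inl (hstart .nil hpath (by simp) halt)
  | cons h p ih =>
    have hp := hpath.of_cons
    rw [SimpleGraph.Walk.support_cons, List.mem_cons] at hv
    obtain rfl | hv := hv
    · obtain heven | hodd := Nat.even_or_odd p.length
      · exact Or.inr ⟨_, hstart p hp heven halt.of_cons, h⟩
      · exact Or.inl (hstart (.cons h p) hpath hodd.add_one halt)
    · exact ih hr hp halt.of_cons hv hstart

theorem exists_isMatchingMap_of_isPath :
    ∀ {x : V} (p : G.Walk x w), p.IsPath → Even p.length →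
      ∃ g, IsMatchingMap G g ∧ fixedPoints g = insert w {v | v ∈ p.support}ᶜ
  | _, .nil, _, _ => ⟨id, isMatchingMap_id G, by simp [insert_eq]⟩
  | _, .cons _ .nil, _, heven => by simp at heven
  | x, .cons (v := y) hxy (.cons (v := z) hyz q), hpath, heven => by
    simp only [SimpleGraph.Walk.cons_isPath_iff, SimpleGraph.Walk.support_cons, List.mem_cons,
      not_or] at hpath
    obtain ⟨⟨hq, hyq⟩, -, hxq⟩ := hpath
    simp only [SimpleGraph.Walk.length_cons, Nat.even_add_one, not_not] at heven
    obtain ⟨g, hg, hfix⟩ := exists_isMatchingMap_of_isPath q hq heven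
    obtain ⟨g', hg', hfix', -⟩ :=
      hg.exists_join (hfix.symm.subset (Or.inr hxq)) (hfix.symm.subset (Or.inr hyq)) hxy
    refine ⟨g', hg', ?_⟩
    ext v
    have hw := q.end_mem_support
    simp only [hfix', hfix, SimpleGraph.Walk.support_cons, List.mem_cons, mem_sdiff,
      mem_insert_iff, mem_compl_iff, mem_ofPred_eq, mem_singleton_iff]
    grind

theorem exists_isNearPerfectOn_of_isCycle {c : G.Walk b b} (hc : c.IsCycle) (hodd : Odd c.length)
    (hw : w ∈ c.support) :
    ∃ g, IsMatchingMap G g ∧ IsNearPerfectOn g {v | v ∈ c.support} w := by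
  classical
  obtain ⟨g, hg, hfix⟩ :
      ∃ g, IsMatchingMap G g ∧ fixedPoints g = insert w {v | v ∈ c.support}ᶜ := by
    have hrotate := hc.rotate hw
    have hlength : (c.rotate w hw).length = c.length := by simp
    have hsupport : ∀ v, v ∈ (c.rotate w hw).support ↔ v ∈ c.support := fun v =>
      SimpleGraph.Walk.mem_support_rotate_iff ..
    simp only [← hlength, ← hsupport] at hodd ⊢
    generalize c.rotate w hw = d at *
    cases d with
    | nil => simp at hodd
    | cons h q =>
      rw [SimpleGraph.Walk.cons_isCycle_iff] at hrotate
      rw [SimpleGraph.Walk.length_cons, Nat.odd_add_one, Nat.not_odd_iff_even] at hodd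
      have hend : ∀ v, v ∈ (SimpleGraph.Walk.cons h q).support ↔ v ∈ q.support := by
        simp
      simpa only [hend] using exists_isMatchingMap_of_isPath q hrotate.1 hodd
  refine ⟨g, hg, fun v hv => ?_, ?_⟩
  · by_contra hgv
    have : g (g v) = g v := hfix.symm.subset (Or.inr hgv)
    rw [hg.involutive] at this
    exact hgv (this ▸ hv)
  · rw [hfix, insert_inter_of_mem (mem_ofPred.2 hw), compl_inter_self, insert_empty_eq]

theorem ncard_support_of_isCycle {c : G.Walk b b} (hc : c.IsCycle) :
    {v | v ∈ c.support}.ncard = c.length := by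
  classical
  cases c with
  | nil => simp at hc
  | cons h q =>
    rw [SimpleGraph.Walk.cons_isCycle_iff] at hc
    have hsupport : {v | v ∈ (SimpleGraph.Walk.cons h q).support} = q.support.toFinset := by
      ext v
      simp +contextual [or_iff_right_iff_imp]
    rw [hsupport, ncard_coe_finset, List.toFinset_card_of_nodup hc.1.support_nodup,
      SimpleGraph.Walk.length_support, SimpleGraph.Walk.length_cons]

theorem IsBlossom.odd_length {c : G.Walk b b} (hc : IsBlossom M c) : Odd c.length := by
  obtain ⟨-, ⟨k, hk, -⟩, -⟩ := hc
  exact ⟨k, hk⟩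

theorem IsBlossom.apply_mem_support [Finite V] (hM : Encodes f M) {c : G.Walk b b}
    (hblossom : IsBlossom M c) {v : V} (hv : v ∈ c.support) (hvb : v ≠ b) :
    f v ∈ c.support ∧ f v ≠ v := by
  obtain ⟨hc, ⟨k, hk, hkM⟩, hbase⟩ := hblossom
  have hf := hM.isMatchingMap.involutive
  have hcount := two_mul_ncard_image_edge (P := {v | s(v, f v) ∈ c.edges}) hf fun v hv => by
    rwa [mem_ofPred_eq, hf, Sym2.eq_swap]
  have hedges : (fun v => s(v, f v)) '' ({v | s(v, f v) ∈ c.edges} \ fixedPoints f) =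
      {e | e ∈ c.edges ∧ e ∈ M.edgeSet} := by
    ext e
    constructor
    · rintro ⟨v, hv, rfl⟩
      exact ⟨hv.1, hM.adj_apply hv.2⟩
    · induction e with | _ x y
      rintro ⟨hxy, hm⟩
      obtain ⟨rfl, hne⟩ := (hM.adj_iff x y).1 hm
      exact ⟨x, ⟨hxy, hne.symm⟩, rfl⟩
  have hsub : {v | s(v, f v) ∈ c.edges} \ fixedPoints f ⊆ {v | v ∈ c.support} \ {b} := by
    rintro v ⟨hvc, hne⟩
    refine ⟨c.fst_mem_support_of_mem_edges hvc, ?_⟩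
    rintro rfl
    exact hbase _ hvc (hM.adj_apply hne) (Sym2.mem_mk_left _ _)
  have hcard : ({v | v ∈ c.support} \ {b}).ncard = 2 * k := by
    rw [ncard_sdiff_singleton_of_mem (mem_ofPred.2 c.start_mem_support),
      ncard_support_of_isCycle hc, hk, Nat.add_sub_cancel]
  have hvmem : v ∈ {v | s(v, f v) ∈ c.edges} \ fixedPoints f := by
    rw [eq_of_subset_of_ncard_le hsub (by rw [hcard, ← hcount, hedges, hkM])]
    exact ⟨hv, hvb⟩
  exact ⟨c.snd_mem_support_of_mem_edges hvmem.1, hvmem.2⟩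

theorem IsFlower.exists_isNearPerfectOn [Finite V] (hf : IsMaximumMatchingMap G f)
    (hM : Encodes f M) {c : G.Walk b b} {p : G.Walk b r} (hflower : IsFlower M c p) :
    ∃ g, IsMaximumMatchingMap G g ∧ IsNearPerfectOn g {v | v ∈ c.support} b := by
  obtain ⟨hblossom, hpath, heven, halt, hr, hmeet⟩ := hflower
  obtain ⟨g, hg, hgb, hoff⟩ := IsAlternating.exists_isMaximumMatchingMap hf hM hr p hpath heven halt
  have hcycle : ∀ v ∈ c.support, v ≠ b → g v ∈ c.support ∧ g v ≠ v := fun v hv hvb => by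
    rw [hoff v fun hvp => hvb (hmeet v hv hvp)]
    exact hblossom.apply_mem_support hM hv hvb
  refine ⟨g, hg, fun v hv => ?_, ?_⟩
  · obtain rfl | hvb := eq_or_ne v b
    · rwa [hgb]
    · exact (hcycle v hv hvb).1
  · refine subset_antisymm (fun v hv => ?_) (singleton_subset_iff.2 ⟨hgb, c.start_mem_support⟩)
    by_contra hvb
    exact (hcycle v hv.2 hvb).2 hv.1

theorem exists_isNearPerfectOn_of_reachSet_nonempty [Finite V] {C : G.Subgraph}
    (hC : (reachSet G C).Nonempty) (hw : w ∈ C.verts) :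
    ∃ g, IsMaximumMatchingMap G g ∧ IsNearPerfectOn g C.verts w := by
  obtain ⟨v, M, hM, b, r, c, p, hflower, rfl, -⟩ := hC
  obtain ⟨f, hfM⟩ := exists_encodes hM.1
  rw [SimpleGraph.Walk.verts_toSubgraph] at hw ⊢
  obtain ⟨g, hg, hgc⟩ := hflower.exists_isNearPerfectOn (hfM.isMaximumMatching_iff.1 hM) hfM
  obtain ⟨h, hh, hhc⟩ := exists_isNearPerfectOn_of_isCycle hflower.1.1 hflower.1.odd_length hw
  exact hg.of_isNearPerfectOn hh hgc hhc

theorem reachSet_subset [Finite V] (C : G.Subgraph) : reachSet G C ⊆ setD G ∪ setA G := by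
  rintro v hv
  by_cases hvD : v ∈ setD G
  · exact Or.inl hvD
  obtain ⟨M, hM, b, r, c, p, hflower, rfl, hvc | hvp⟩ := id hv
  · obtain ⟨g, hg, hgv⟩ := exists_isNearPerfectOn_of_reachSet_nonempty ⟨v, hv⟩
      (c.mem_verts_toSubgraph.2 hvc)
    exact Or.inl (hg.mem_setD hgv.apply_eq)
  · obtain ⟨-, hpath, -, halt, hr, -⟩ := hflower
    obtain ⟨f, hfM⟩ := exists_encodes hM.1
    exact (halt.mem_setD_or_adj (hfM.isMaximumMatching_iff.1 hM) hfM hr hpath hvp).imp_right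
      fun h => ⟨h, hvD⟩

end Flower

section FactorCritical

variable {V ι : Type*} {G : SimpleGraph V} {F : V → V} {Y : ι → Set V} {w : ι → V} {i : ι}
  {u v x : V}

theorem setA_union_setC_subset (G : SimpleGraph V) : setA G ∪ setC G ⊆ (setD G)ᶜ :=
  union_subset (fun _ hv => hv.2) fun _ hv hvD => hv (Or.inl hvD)

theorem mem_isolatedD_iff : v ∈ isolatedD G ↔ v ∈ setD G ∧ ∀ u ∈ setD G, ¬ G.Adj v u := by
  constructor
  · rintro ⟨⟨v, hv⟩, hisolated, rfl⟩
    exact ⟨hv, fun u hu huv => @hisolated ⟨u, hu⟩ huv⟩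
  · rintro ⟨hv, hisolated⟩
    exact ⟨⟨v, hv⟩, fun u huv => hisolated u.1 u.2 huv, rfl⟩

theorem mem_setA_of_adj_of_mem_isolatedD (hu : u ∈ isolatedD G) (huv : G.Adj u v) : v ∈ setA G :=
  have ⟨huD, hisolated⟩ := mem_isolatedD_iff.1 hu
  ⟨⟨u, huD, huv.symm⟩, fun hv => hisolated v hv huv⟩

/-- A maximum matching that, for each `i`, perfectly matches `Y i \ {w i}` within itself. -/
structure IsTransversalMatchingMap (G : SimpleGraph V) (Y : ι → Set V) (w : ι → V) (F : V → V) :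
    Prop extends IsMaximumMatchingMap G F where
  isNearPerfectOn : ∀ i, IsNearPerfectOn F (Y i) (w i)

/-- Sets `Y i` that play the role of the components of `G[D(G)]` with more than one vertex in the
Gallai–Edmonds decomposition of `G`: they cover the edges of `G[D(G)]`, and some maximum matching
is near-perfect on all of them at once, missing any prescribed vertex of each. -/
structure IsFactorCriticalFamily (G : SimpleGraph V) (Y : ι → Set V) : Prop where
  nontrivial : ∀ i, (Y i).Nontrivial
  exists_mem_of_adj : ∀ u ∈ setD G, ∀ v ∈ setD G, G.Adj u v → ∃ i, u ∈ Y i ∧ v ∈ Y i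
  exists_matching : ∀ w : ι → V, (∀ i, w i ∈ Y i) → ∃ F, IsTransversalMatchingMap G Y w F

theorem IsTransversalMatchingMap.apply_notMem (hF : IsTransversalMatchingMap G Y w F)
    (hv : v ∉ Y i) : F v ∉ Y i := fun hFv =>
  hv (hF.involutive v ▸ (hF.isNearPerfectOn i).mapsTo hFv)

namespace IsFactorCriticalFamily

theorem exists_matching_apply_eq (h : IsFactorCriticalFamily G Y) {S : Set V}
    (hS : ∀ j, (Y j \ S).Nonempty) (hx : x ∈ Y i \ S) :
    ∃ F w, IsTransversalMatchingMap G Y w F ∧ (∀ j, w j ∉ S) ∧ F x = x := by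
  obtain ⟨w, hw, rfl⟩ :=
    (eval_image_univ_pi (i := i) (univ_pi_nonempty_iff.2 hS)).symm.subset hx
  obtain ⟨F, hF⟩ := h.exists_matching w fun j => (hw j trivial).1
  exact ⟨F, w, hF, fun j => (hw j trivial).2, (hF.isNearPerfectOn i).apply_eq⟩

theorem exists_matching_apply_eq_of_mem (h : IsFactorCriticalFamily G Y) (hx : x ∈ Y i) :
    ∃ F w, IsTransversalMatchingMap G Y w F ∧ F x = x := by
  obtain ⟨F, w, hF, -, hFx⟩ := h.exists_matching_apply_eq (S := ∅)
    (fun j => by simpa using (h.nontrivial j).nonempty) (by simpa using hx)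
  exact ⟨F, w, hF, hFx⟩

theorem exists_adj (h : IsFactorCriticalFamily G Y) (hx : x ∈ Y i) : ∃ y ∈ Y i, G.Adj x y := by
  obtain ⟨z, hz, hzx⟩ := (h.nontrivial i).exists_ne x
  obtain ⟨F, w, hF, hFz⟩ := h.exists_matching_apply_eq_of_mem hz
  have hnear := hF.isNearPerfectOn i
  exact ⟨F x, hnear.mapsTo hx, hF.adj x fun hFx =>
    hzx ((hnear.eq_of_apply_eq hz hFz).trans (hnear.eq_of_apply_eq hx hFx).symm)⟩

theorem mem_isolatedD (h : IsFactorCriticalFamily G Y) (hv : v ∈ setD G) (hvY : v ∉ ⋃ i, Y i) :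
    v ∈ isolatedD G :=
  mem_isolatedD_iff.2 ⟨hv, fun u hu huv => hvY <|
    have ⟨i, hvi, _⟩ := h.exists_mem_of_adj v hv u hu huv
    mem_iUnion_of_mem i hvi⟩

variable [Finite V]

theorem subset_setD (h : IsFactorCriticalFamily G Y) (i : ι) : Y i ⊆ setD G := fun _ hx =>
  have ⟨_, _, hF, hFx⟩ := h.exists_matching_apply_eq_of_mem hx
  hF.mem_setD hFx

theorem notMem_isolatedD (h : IsFactorCriticalFamily G Y) (hx : x ∈ Y i) : x ∉ isolatedD G :=
  fun hX =>
    have ⟨y, hy, hxy⟩ := h.exists_adj hx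
    (mem_isolatedD_iff.1 hX).2 y (h.subset_setD i hy) hxy

theorem of_le {G' : SimpleGraph V} (h : IsFactorCriticalFamily G' Y) (hle : G' ≤ G)
    (hadj : ∀ u ∈ setD G', ∀ v, G.Adj u v → G'.Adj u v) : IsFactorCriticalFamily G Y := by
  obtain ⟨hD, hmax⟩ := setD_eq_and_isMaximumMatchingMap_of_le hle hadj
  refine ⟨h.nontrivial, fun u hu v hv huv => ?_, fun w hw => ?_⟩
  · rw [hD] at hu hv
    exact h.exists_mem_of_adj u hu v hv (hadj u hu v huv)
  · obtain ⟨F, hF⟩ := h.exists_matching w hw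
    exact ⟨F, hmax F hF.toIsMaximumMatchingMap, hF.isNearPerfectOn⟩

theorem apply_mem_isolatedD (h : IsFactorCriticalFamily G Y) (hF : IsTransversalMatchingMap G Y w F)
    (hv : v ∈ setA G) : F v ∈ isolatedD G := by
  refine h.mem_isolatedD (hF.mem_setD_of_mem_setA hv) fun hFv => ?_
  obtain ⟨i, hi⟩ := mem_iUnion.1 hFv
  exact hF.apply_notMem (fun hvi => hv.2 (h.subset_setD i hvi)) hi

theorem image_setA (h : IsFactorCriticalFamily G Y) (hF : IsTransversalMatchingMap G Y w F) :
    F '' setA G = isolatedD G \ fixedPoints F := by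
  refine Subset.antisymm ?_ fun x ⟨hx, hFx⟩ =>
    ⟨F x, mem_setA_of_adj_of_mem_isolatedD hx (hF.adj x hFx), hF.involutive x⟩
  rintro _ ⟨a, ha, rfl⟩
  refine ⟨h.apply_mem_isolatedD hF ha, fun hfix => ha.2 (hF.mem_setD ?_)⟩
  exact hF.involutive.injective hfix

theorem ncard_isolatedD_inter_add (h : IsFactorCriticalFamily G Y)
    (hF : IsTransversalMatchingMap G Y w F) :
    (isolatedD G ∩ fixedPoints F).ncard + (setA G).ncard = (isolatedD G).ncard := by
  rw [← ncard_image_of_injective (setA G) hF.involutive.injective, h.image_setA hF]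
  exact ncard_inter_add_ncard_sdiff_eq_ncard _ _

end IsFactorCriticalFamily

end FactorCritical

section Critical

variable {V ι : Type*} {G : SimpleGraph V} {F : V → V} {Y : ι → Set V} {w : ι → V} {i : ι}
  {L R S T : Set V} {u v x : V}

theorem disjoint_nbhd_of_isIndepSet (hS : G.IsIndepSet S) : Disjoint S (nbhd G S) :=
  disjoint_left.2 fun _ hv ⟨_, hu, huv⟩ => hS hu hv huv.ne huv

theorem IsMatchingMap.image_sdiff_fixedPoints_subset_nbhd (hF : IsMatchingMap G F) (S : Set V) :
    F '' (S \ fixedPoints F) ⊆ nbhd G S := by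
  rintro _ ⟨v, ⟨hv, hFv⟩, rfl⟩
  exact ⟨v, hv, hF.adj v hFv⟩

theorem not_adj_of_mem_setD_of_mem_setC (hu : u ∈ setD G) (hv : v ∈ setC G) : ¬ G.Adj u v :=
  fun huv => hv (Or.inr ⟨⟨u, hu, huv.symm⟩, fun hvD => hv (Or.inl hvD)⟩)

theorem IsMaximumMatchingMap.apply_ne_of_mem_setC [Finite V] (hF : IsMaximumMatchingMap G F)
    (hv : v ∈ setC G) : F v ≠ v := fun hFv =>
  hv (Or.inl (hF.mem_setD hFv))

theorem IsMaximumMatchingMap.mapsTo_setC [Finite V] (hF : IsMaximumMatchingMap G F) :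
    MapsTo F (setC G) (setC G) := by
  rintro v hv (hD | hA)
  · exact not_adj_of_mem_setD_of_mem_setC hD hv (hF.adj v (hF.apply_ne_of_mem_setC hv)).symm
  · exact hv (Or.inl (hF.involutive v ▸ hF.mem_setD_of_mem_setA hA))

theorem two_mul_ncard_eq_ncard_union_nbhd_add [Finite V] (hS : G.IsIndepSet S) :
    2 * (S.ncard : ℤ) = (S ∪ nbhd G S).ncard + diff G S := by
  rw [diff, ncard_union_eq (disjoint_nbhd_of_isIndepSet hS)]
  push_cast
  ring

/-- A bipartition of `G[C(G)]`, as a pair of sets of vertices of `G`. -/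
structure IsBipartitionSetC (G : SimpleGraph V) (L R : Set V) : Prop where
  union_eq : L ∪ R = setC G
  disjoint : Disjoint L R
  isIndepSet_left : G.IsIndepSet L
  isIndepSet_right : G.IsIndepSet R

theorem exists_isBipartitionSetC (hC : (G.induce (setC G)).IsBipartite) :
    ∃ L R, IsBipartitionSetC G L R := by
  obtain ⟨c⟩ := hC
  have hindep (j : Fin 2) : G.IsIndepSet (Subtype.val '' (c ⁻¹' {j})) := by
    rintro _ ⟨u, hu, rfl⟩ _ ⟨v, hv, rfl⟩ - huv
    exact c.valid (v := u) (w := v) huv (hu.trans hv.symm)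
  refine ⟨_, _, ?_, ?_, hindep 0, hindep 1⟩
  · rw [← image_union, ← preimage_union, singleton_union,
      show ({0, 1} : Set (Fin 2)) = univ from (Set.ext fun j => by fin_cases j <;> simp),
      preimage_univ, image_univ, Subtype.range_coe]
  · exact (disjoint_image_iff Subtype.val_injective).2 (Disjoint.preimage c (by simp))

namespace IsBipartitionSetC

theorem symm (hLR : IsBipartitionSetC G L R) : IsBipartitionSetC G R L :=
  ⟨union_comm L R ▸ hLR.union_eq, hLR.disjoint.symm, hLR.isIndepSet_right, hLR.isIndepSet_left⟩

theorem subset_left (hLR : IsBipartitionSetC G L R) : L ⊆ setC G :=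
  hLR.union_eq ▸ subset_union_left

theorem isIndepSet_isolatedD_union (hLR : IsBipartitionSetC G L R) :
    G.IsIndepSet (isolatedD G ∪ L) := by
  have hX : ∀ u ∈ isolatedD G, ∀ v ∈ isolatedD G ∪ L, ¬ G.Adj u v := by
    rintro u hu v (hv | hv)
    · exact (mem_isolatedD_iff.1 hu).2 v (mem_isolatedD_iff.1 hv).1
    · exact not_adj_of_mem_setD_of_mem_setC (mem_isolatedD_iff.1 hu).1 (hLR.subset_left hv)
  rintro u hu v hv huv hadj
  rcases hu with hu | hu
  · exact hX u hu v hv hadj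
  · rcases hv with hv | hv
    · exact hX v hv u (Or.inr hu) hadj.symm
    · exact hLR.isIndepSet_left hu hv huv hadj

theorem nbhd_isolatedD_union_subset (hLR : IsBipartitionSetC G L R) :
    nbhd G (isolatedD G ∪ L) ⊆ setA G ∪ R := by
  rintro v ⟨u, hu | hu, huv⟩
  · exact Or.inl (mem_setA_of_adj_of_mem_isolatedD hu huv)
  · by_cases hvC : v ∈ setC G
    · rw [← hLR.union_eq] at hvC
      exact Or.inr (hvC.resolve_left fun hv => hLR.isIndepSet_left hu hv huv.ne huv)
    · refine Or.inl ((not_not.1 hvC).resolve_left fun hvD => ?_)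
      exact not_adj_of_mem_setD_of_mem_setC hvD (hLR.subset_left hu) huv.symm

variable [Finite V]

theorem mapsTo_right_left (hLR : IsBipartitionSetC G L R) (hF : IsMaximumMatchingMap G F) :
    MapsTo F R L := by
  intro v hv
  have hvC : v ∈ setC G := hLR.symm.subset_left hv
  have hFv := hF.mapsTo_setC hvC
  rw [← hLR.union_eq] at hFv
  have hadj := hF.adj v (hF.apply_ne_of_mem_setC hvC)
  exact hFv.resolve_right fun hFv => hLR.isIndepSet_right hv hFv hadj.ne hadj

theorem le_diff_isolatedD_union (hLR : IsBipartitionSetC G L R) :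
    ((isolatedD G).ncard : ℤ) - (setA G).ncard ≤ diff G (isolatedD G ∪ L) := by
  obtain ⟨F, hF⟩ := exists_isMaximumMatchingMap G
  have hXL : (isolatedD G ∪ L).ncard = (isolatedD G).ncard + L.ncard :=
    ncard_union_eq <| disjoint_left.2 fun v hv hvL =>
      hLR.subset_left hvL (Or.inl (mem_isolatedD_iff.1 hv).1)
  have hnbhd := (ncard_le_ncard hLR.nbhd_isolatedD_union_subset).trans (ncard_union_le _ _)
  have hRL : R.ncard ≤ L.ncard :=
    ncard_le_ncard_of_injOn F (hLR.mapsTo_right_left hF) hF.involutive.injective.injOn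
  simp only [diff]
  lia

end IsBipartitionSetC

namespace IsFactorCriticalFamily

theorem sdiff_nonempty_of_isIndepSet (h : IsFactorCriticalFamily G Y) (hS : G.IsIndepSet S)
    (i : ι) : (Y i \ S).Nonempty := by
  obtain ⟨x, hx⟩ := (h.nontrivial i).nonempty
  obtain ⟨y, hy, hxy⟩ := h.exists_adj hx
  by_cases hxS : x ∈ S
  · exact ⟨y, hy, fun hyS => hS hxS hyS hxy.ne hxy⟩
  · exact ⟨x, hx, hxS⟩

theorem exists_matching_notMem (h : IsFactorCriticalFamily G Y) (hS : G.IsIndepSet S) :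
    ∃ F w, IsTransversalMatchingMap G Y w F ∧ ∀ i, w i ∉ S := by
  choose w hw using h.sdiff_nonempty_of_isIndepSet hS
  obtain ⟨F, hF⟩ := h.exists_matching w fun i => (hw i).1
  exact ⟨F, w, hF, fun i => (hw i).2⟩

variable [Finite V]

theorem inter_fixedPoints_subset (h : IsFactorCriticalFamily G Y)
    (hF : IsTransversalMatchingMap G Y w F) (hw : ∀ i, w i ∉ S) :
    S ∩ fixedPoints F ⊆ isolatedD G ∩ fixedPoints F := fun v ⟨hvS, hFv⟩ => by
  refine ⟨h.mem_isolatedD (hF.mem_setD hFv) fun hvY => ?_, hFv⟩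
  obtain ⟨i, hi⟩ := mem_iUnion.1 hvY
  exact hw i ((hF.isNearPerfectOn i).eq_of_apply_eq hi hFv ▸ hvS)

theorem ncard_add_ncard_setA_le (h : IsFactorCriticalFamily G Y)
    (hF : IsTransversalMatchingMap G Y w F) (hw : ∀ i, w i ∉ S) :
    S.ncard + (setA G).ncard ≤ (F '' (S \ fixedPoints F)).ncard + (isolatedD G).ncard := by
  rw [ncard_image_of_injective _ hF.involutive.injective]
  have hmissed := ncard_le_ncard (h.inter_fixedPoints_subset hF hw)
  have hS := ncard_inter_add_ncard_sdiff_eq_ncard S (fixedPoints F)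
  have hX := h.ncard_isolatedD_inter_add hF
  lia

theorem diff_le (h : IsFactorCriticalFamily G Y) (hS : G.IsIndepSet S) :
    diff G S ≤ (isolatedD G).ncard - (setA G).ncard := by
  obtain ⟨F, w, hF, hw⟩ := h.exists_matching_notMem hS
  have hnbhd := ncard_le_ncard (hF.image_sdiff_fixedPoints_subset_nbhd S)
  have hcard := h.ncard_add_ncard_setA_le hF hw
  rw [diff]
  lia

theorem isCriticalIndepSet_isolatedD_union (h : IsFactorCriticalFamily G Y)
    (hLR : IsBipartitionSetC G L R) : IsCriticalIndepSet G (isolatedD G ∪ L) :=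
  ⟨hLR.isIndepSet_isolatedD_union, fun _ hT => (h.diff_le hT).trans hLR.le_diff_isolatedD_union⟩

theorem diff_eq (h : IsFactorCriticalFamily G Y) (hLR : IsBipartitionSetC G L R)
    (hS : IsCriticalIndepSet G S) : diff G S = (isolatedD G).ncard - (setA G).ncard :=
  (h.diff_le hS.1).antisymm <|
    hLR.le_diff_isolatedD_union.trans (hS.2 _ hLR.isIndepSet_isolatedD_union)

theorem nbhd_eq_image (h : IsFactorCriticalFamily G Y) (hLR : IsBipartitionSetC G L R)
    (hS : IsCriticalIndepSet G S) (hF : IsTransversalMatchingMap G Y w F) (hw : ∀ i, w i ∉ S) :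
    nbhd G S = F '' (S \ fixedPoints F) := by
  refine (eq_of_subset_of_ncard_le (hF.image_sdiff_fixedPoints_subset_nbhd S) ?_).symm
  have hcard := h.ncard_add_ncard_setA_le hF hw
  have hdiff := h.diff_eq hLR hS
  rw [diff] at hdiff
  lia

theorem notMem_nbhd (h : IsFactorCriticalFamily G Y) (hLR : IsBipartitionSetC G L R)
    (hS : IsCriticalIndepSet G S) (hx : x ∈ Y i) : x ∉ nbhd G S := by
  intro hxN
  have hxS : x ∉ S := (disjoint_nbhd_of_isIndepSet hS.1).notMem_of_mem_right hxN
  obtain ⟨F, w, hF, hw, hFx⟩ :=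
    h.exists_matching_apply_eq (h.sdiff_nonempty_of_isIndepSet hS.1) ⟨hx, hxS⟩
  rw [h.nbhd_eq_image hLR hS hF hw] at hxN
  obtain ⟨s, hs, hsx⟩ := hxN
  exact hxS (hF.involutive.injective (hsx.trans hFx.symm) ▸ hs.1)

theorem union_nbhd_subset (h : IsFactorCriticalFamily G Y) (hLR : IsBipartitionSetC G L R)
    (hS : IsCriticalIndepSet G S) : S ∪ nbhd G S ⊆ (⋃ i, Y i)ᶜ := by
  intro x hx hxY
  obtain ⟨i, hi⟩ := mem_iUnion.1 hxY
  obtain ⟨y, hy, hxy⟩ := h.exists_adj hi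
  exact hx.elim (fun hxS => h.notMem_nbhd hLR hS hy ⟨x, hxS, hxy⟩) (h.notMem_nbhd hLR hS hi)

theorem compl_subset_union_nbhd (h : IsFactorCriticalFamily G Y) (hLR : IsBipartitionSetC G L R) :
    (⋃ i, Y i)ᶜ ⊆ isolatedD G ∪ L ∪ nbhd G (isolatedD G ∪ L) := by
  obtain ⟨F, w, hF, -⟩ := h.exists_matching_notMem hLR.isIndepSet_isolatedD_union
  have hmatched {v} (hv : F v ∈ isolatedD G ∪ L) (hFv : F v ≠ v) :
      v ∈ nbhd G (isolatedD G ∪ L) := ⟨F v, hv, (hF.adj v hFv).symm⟩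
  intro v hv
  by_cases hvC : v ∈ setC G
  · have hFv := hF.apply_ne_of_mem_setC hvC
    rw [← hLR.union_eq] at hvC
    exact hvC.imp Or.inr fun hvR => hmatched (Or.inr (hLR.mapsTo_right_left hF.1 hvR)) hFv
  · refine (not_not.1 hvC).imp (fun hvD => Or.inl (h.mem_isolatedD hvD hv)) fun hvA => ?_
    exact hmatched (Or.inl (h.apply_mem_isolatedD hF hvA)) fun hFv => hvA.2 (hF.mem_setD hFv)

theorem isMaximumCriticalIndepSet_isolatedD_union (h : IsFactorCriticalFamily G Y)
    (hLR : IsBipartitionSetC G L R) : IsMaximumCriticalIndepSet G (isolatedD G ∪ L) := by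
  have hcrit := h.isCriticalIndepSet_isolatedD_union hLR
  refine ⟨hcrit, fun T hT => ?_⟩
  have hcover := ncard_le_ncard
    ((h.union_nbhd_subset hLR hT).trans (h.compl_subset_union_nbhd hLR))
  have hXL := two_mul_ncard_eq_ncard_union_nbhd_add hcrit.1
  rw [h.diff_eq hLR hcrit, ← h.diff_eq hLR hT] at hXL
  have hT := two_mul_ncard_eq_ncard_union_nbhd_add hT.1
  lia

theorem union_nbhd_eq_of_isMaximumCriticalIndepSet (h : IsFactorCriticalFamily G Y)
    (hLR : IsBipartitionSetC G L R) (hS : IsMaximumCriticalIndepSet G S) :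
    S ∪ nbhd G S = (⋃ i, Y i)ᶜ := by
  refine eq_of_subset_of_ncard_le (h.union_nbhd_subset hLR hS.1) ?_
  have hcrit := h.isCriticalIndepSet_isolatedD_union hLR
  have hle := hS.2 _ hcrit
  have hcover := ncard_le_ncard (h.compl_subset_union_nbhd hLR)
  have hXL := two_mul_ncard_eq_ncard_union_nbhd_add hcrit.1
  rw [h.diff_eq hLR hcrit, ← h.diff_eq hLR hS.1] at hXL
  have hS := two_mul_ncard_eq_ncard_union_nbhd_add hS.1.1
  lia

theorem nbhd_inter_setD_subset (h : IsFactorCriticalFamily G Y) (hLR : IsBipartitionSetC G L R)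
    (hS : IsCriticalIndepSet G S) (hF : IsTransversalMatchingMap G Y w F) (hw : ∀ i, w i ∉ S) :
    nbhd G S ∩ setD G ⊆ F '' (S ∩ setA G) := by
  rintro x ⟨hxN, hxD⟩
  have hxX := h.mem_isolatedD hxD (h.union_nbhd_subset hLR hS (Or.inr hxN))
  rw [h.nbhd_eq_image hLR hS hF hw] at hxN
  obtain ⟨s, ⟨hsS, hsF⟩, rfl⟩ := hxN
  exact ⟨s, ⟨hsS, mem_setA_of_adj_of_mem_isolatedD hxX (hF.adj s hsF).symm⟩, rfl⟩

theorem disjoint_nbhd_setD (h : IsFactorCriticalFamily G Y) (hLR : IsBipartitionSetC G L R)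
    (hS : IsCriticalIndepSet G S) : Disjoint (nbhd G S) (setD G) := by
  rw [disjoint_left]
  intro x hxN hxD
  obtain ⟨F, w, hF, hw⟩ := h.exists_matching_notMem hS.1
  obtain ⟨g, hg, hgx⟩ := mem_setD_iff.1 hxD
  have himage : g '' (S ∩ setA G) ⊆ nbhd G S ∩ setD G := by
    rintro _ ⟨a, ⟨haS, haA⟩, rfl⟩
    exact ⟨⟨a, haS, hg.adj a fun hga => haA.2 (hg.mem_setD hga)⟩, hg.mem_setD_of_mem_setA haA⟩
  have hcard : (nbhd G S ∩ setD G).ncard ≤ (g '' (S ∩ setA G)).ncard := by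
    rw [ncard_image_of_injective _ hg.involutive.injective,
      ← ncard_image_of_injective (S ∩ setA G) hF.involutive.injective]
    exact ncard_le_ncard (h.nbhd_inter_setD_subset hLR hS hF hw)
  obtain ⟨a, ⟨-, haA⟩, hax⟩ := (eq_of_subset_of_ncard_le himage hcard).symm.subset ⟨hxN, hxD⟩
  exact haA.2 (hg.involutive.injective (hax.trans hgx.symm) ▸ hxD)

theorem isolatedD_subset (h : IsFactorCriticalFamily G Y) (hLR : IsBipartitionSetC G L R)
    (hS : IsMaximumCriticalIndepSet G S) : isolatedD G ⊆ S := by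
  intro x hx
  have hxY : x ∈ (⋃ i, Y i)ᶜ := fun hxY =>
    have ⟨i, hi⟩ := mem_iUnion.1 hxY
    h.notMem_isolatedD hi hx
  rw [← h.union_nbhd_eq_of_isMaximumCriticalIndepSet hLR hS] at hxY
  exact hxY.resolve_right fun hxN =>
    (h.disjoint_nbhd_setD hLR hS.1).notMem_of_mem_left hxN (mem_isolatedD_iff.1 hx).1

theorem nucleus_eq_isolatedD (h : IsFactorCriticalFamily G Y) (hLR : IsBipartitionSetC G L R) :
    nucleus G = isolatedD G := by
  refine Subset.antisymm (fun v hv => ?_) (subset_sInter fun S hS => h.isolatedD_subset hLR hS)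
  have hvL : v ∈ isolatedD G ∪ L := hv _ (h.isMaximumCriticalIndepSet_isolatedD_union hLR)
  have hvR : v ∈ isolatedD G ∪ R := hv _ (h.isMaximumCriticalIndepSet_isolatedD_union hLR.symm)
  exact hvL.elim id fun hL => hvR.resolve_right (hLR.disjoint.notMem_of_mem_left hL)

end IsFactorCriticalFamily

end Critical

section DisjointUnion

variable {V κ : Type*} {G : SimpleGraph V} {part : V → κ} {f : V → V} {p : κ}

/-- The disjoint union of the subgraphs of `G` induced by the fibres of `part`, on the vertex set
of `G`. -/
def partGraph (G : SimpleGraph V) (part : V → κ) : SimpleGraph V where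
  Adj u v := G.Adj u v ∧ part u = part v
  symm := ⟨fun _ _ h => ⟨h.1.symm, h.2.symm⟩⟩
  loopless := ⟨fun _ h => h.1.ne rfl⟩

/-- The subgraph of `G` induced by a fibre of `part`. -/
abbrev piece (G : SimpleGraph V) (part : V → κ) (p : κ) : SimpleGraph {v | part v = p} :=
  G.induce {v | part v = p}

/-- The self-map of `V` that restricts to `m p` on the fibre of `part` over `p`. -/
def glue (m : ∀ p, {v | part v = p} → {v | part v = p}) : V → V :=
  fun v => m (part v) ⟨v, rfl⟩

variable {m : ∀ p, {v | part v = p} → {v | part v = p}}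

theorem partGraph_le : partGraph G part ≤ G := fun _ _ h => h.1

theorem glue_apply (v : {v | part v = p}) : glue m v = m p v := by
  obtain ⟨v, rfl⟩ := v
  rfl

theorem glue_apply_eq_iff (v : {v | part v = p}) : glue m v = v ↔ m p v = v := by
  rw [glue_apply, Subtype.coe_inj]

theorem ncard_fixedPoints_glue [Finite V] [Fintype κ]
    (m : ∀ p, {v | part v = p} → {v | part v = p}) :
    (fixedPoints (glue m)).ncard = ∑ p, (fixedPoints (m p)).ncard := by
  have e : fixedPoints (glue m) ≃ Σ p, fixedPoints (m p) :=
    { toFun := fun v => ⟨part v, ⟨v, rfl⟩, Subtype.ext v.2⟩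
      invFun := fun x => ⟨x.2.1, (glue_apply_eq_iff x.2.1).2 x.2.2⟩
      left_inv := fun _ => rfl
      right_inv := by
        rintro ⟨p, ⟨⟨v, rfl⟩, hv⟩⟩
        rfl }
  simp only [← Nat.card_coe_set_eq, Nat.card_congr e, Nat.card_sigma]

theorem isMatchingMap_glue (hm : ∀ p, IsMatchingMap (piece G part p) (m p)) :
    IsMatchingMap (partGraph G part) (glue m) where
  involutive v := (glue_apply (m _ ⟨v, rfl⟩)).trans (congrArg Subtype.val ((hm _).involutive _))
  adj v hv := ⟨(hm (part v)).adj ⟨v, rfl⟩ fun h => hv (congrArg Subtype.val h),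
    (m (part v) ⟨v, rfl⟩).2.symm⟩

theorem IsMatchingMap.exists_glue_eq (hf : IsMatchingMap (partGraph G part) f) :
    ∃ m : ∀ p, {v | part v = p} → {v | part v = p},
      (∀ p, IsMatchingMap (piece G part p) (m p)) ∧ glue m = f := by
  have hpart (v : V) : part (f v) = part v := by
    by_cases hv : f v = v
    · rw [hv]
    · exact (hf.adj v hv).2.symm
  exact ⟨fun p v => ⟨f v, (hpart v).trans v.2⟩, fun p => ⟨fun v => Subtype.ext (hf.involutive v),
    fun v hv => (hf.adj v fun h => hv (Subtype.ext h)).1⟩, rfl⟩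

variable [Finite V] [Finite κ]

theorem isMaximumMatchingMap_glue (hm : ∀ p, IsMaximumMatchingMap (piece G part p) (m p)) :
    IsMaximumMatchingMap (partGraph G part) (glue m) := by
  have := Fintype.ofFinite κ
  refine ⟨isMatchingMap_glue fun p => (hm p).toIsMatchingMap, fun g hg => ?_⟩
  obtain ⟨n, hn, rfl⟩ := hg.exists_glue_eq
  rw [ncard_fixedPoints_glue, ncard_fixedPoints_glue]
  exact Finset.sum_le_sum fun p _ => (hm p).ncard_le _ (hn p)

theorem IsMaximumMatchingMap.exists_glue_eq (hf : IsMaximumMatchingMap (partGraph G part) f) :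
    ∃ m : ∀ p, {v | part v = p} → {v | part v = p},
      (∀ p, IsMaximumMatchingMap (piece G part p) (m p)) ∧ glue m = f := by
  have := Fintype.ofFinite κ
  obtain ⟨m, hm, rfl⟩ := hf.toIsMatchingMap.exists_glue_eq
  choose n hn using fun p => exists_isMaximumMatchingMap (piece G part p)
  have hsum := hf.ncard_le _ (isMatchingMap_glue fun p => (hn p).toIsMatchingMap)
  rw [ncard_fixedPoints_glue, ncard_fixedPoints_glue] at hsum
  have hle : ∀ p ∈ Finset.univ, (fixedPoints (n p)).ncard ≤ (fixedPoints (m p)).ncard :=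
    fun p _ => (hn p).ncard_le _ (hm p)
  have heq := (Finset.sum_eq_sum_iff_of_le hle).1 ((Finset.sum_le_sum hle).antisymm hsum)
  exact ⟨m, fun p => (hn p).of_ncard_le (hm p) (heq p (Finset.mem_univ p)).ge, rfl⟩

theorem mem_setD_piece_iff {v : {v | part v = p}} :
    v ∈ setD (piece G part p) ↔ v.1 ∈ setD (partGraph G part) := by
  classical
  constructor <;> intro hv <;> obtain ⟨f, hf, hfv⟩ := mem_setD_iff.1 hv
  · choose m hm using fun q => exists_isMaximumMatchingMap (piece G part q)
    have hglue := isMaximumMatchingMap_glue (G := G) (m := update m p f) fun q => by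
      obtain rfl | hq := eq_or_ne q p
      · rwa [update_self]
      · rw [update_of_ne hq]
        exact hm q
    exact hglue.mem_setD ((glue_apply_eq_iff v).2 (by rw [update_self, hfv]))
  · obtain ⟨m, hm, rfl⟩ := hf.exists_glue_eq
    exact (hm p).mem_setD ((glue_apply_eq_iff v).1 hfv)

theorem mem_setA_piece_iff {v : {v | part v = p}} :
    v ∈ setA (piece G part p) ↔ v.1 ∈ setA (partGraph G part) := by
  refine and_congr ⟨?_, ?_⟩ mem_setD_piece_iff.not
  · rintro ⟨w, hw, hvw⟩
    exact ⟨w, mem_setD_piece_iff.1 hw, hvw, v.2.trans w.2.symm⟩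
  · rintro ⟨w, hw, hvw⟩
    exact ⟨⟨w, hvw.2.symm.trans v.2⟩, mem_setD_piece_iff.2 hw, hvw.1⟩

theorem isFactorCriticalFamily_partGraph {ι : κ → Type*} {Y : ∀ p, ι p → Set {v | part v = p}}
    (h : ∀ p, IsFactorCriticalFamily (piece G part p) (Y p)) :
    IsFactorCriticalFamily (partGraph G part) fun x : Σ p, ι p => Subtype.val '' Y x.1 x.2 where
  nontrivial x := ((h x.1).nontrivial x.2).image Subtype.val_injective
  exists_mem_of_adj u hu v hv huv := by
    obtain ⟨i, hui, hvi⟩ := (h (part u)).exists_mem_of_adj ⟨u, rfl⟩ (mem_setD_piece_iff.2 hu)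
      ⟨v, huv.2.symm⟩ (mem_setD_piece_iff.2 hv) huv.1
    exact ⟨⟨part u, i⟩, ⟨_, hui, rfl⟩, ⟨_, hvi, rfl⟩⟩
  exists_matching w hw := by
    choose z hz hzw using hw
    choose m hm using fun p => (h p).exists_matching (fun i => z ⟨p, i⟩) fun i => hz ⟨p, i⟩
    refine ⟨glue m, isMaximumMatchingMap_glue fun p => (hm p).toIsMaximumMatchingMap, ?_⟩
    rintro ⟨p, i⟩
    have hnear := (hm p).isNearPerfectOn i
    rw [← hzw]
    refine ⟨?_, Subset.antisymm ?_ ?_⟩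
    · rintro _ ⟨v, hv, rfl⟩
      exact ⟨m p v, hnear.mapsTo hv, (glue_apply v).symm⟩
    · rintro _ ⟨hfix, v, hv, rfl⟩
      exact congrArg Subtype.val (hnear.eq_of_apply_eq hv ((glue_apply_eq_iff v).1 hfix))
    · rintro _ rfl
      exact ⟨(glue_apply_eq_iff _).2 hnear.apply_eq, ⟨_, hz ⟨p, i⟩, rfl⟩⟩

end DisjointUnion

section Pieces

variable {V : Type*} [Finite V] {G : SimpleGraph V} {C : G.Subgraph}

theorem setC_eq_empty_of_reachSet_eq_univ (hC : reachSet G C = univ) : setC G = ∅ :=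
  compl_empty_iff.2 (univ_subset_iff.1 (hC ▸ reachSet_subset C))

theorem isFactorCriticalFamily_of_forall_isOddCycle_eq (hC : IsOddCycle G C)
    (huniq : ∀ C', IsOddCycle G C' → C' = C) (hreach : (reachSet G C).Nonempty) :
    IsFactorCriticalFamily G fun _ : Unit => C.verts where
  nontrivial _ := by
    obtain ⟨v, c, hc, -, rfl⟩ := hC
    exact ⟨v, c.start_mem_verts_toSubgraph, c.snd,
      c.mem_verts_toSubgraph.2 (c.getVert_mem_support 1), (c.adj_snd hc.not_nil).ne⟩
  exists_mem_of_adj u hu v hv huv := by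
    have hmem {u v} (hu : u ∈ setD G) (hv : v ∈ setD G) (huv : G.Adj u v) : v ∈ C.verts := by
      obtain ⟨c, hc, hodd⟩ := exists_isCycle_odd_length_of_adj hu hv huv
      rw [← huniq _ ⟨v, c, hc, hodd, rfl⟩]
      exact c.start_mem_verts_toSubgraph
    exact ⟨(), hmem hv hu huv.symm, hmem hu hv huv⟩
  exists_matching w hw := by
    obtain ⟨F, hF, hnear⟩ := exists_isNearPerfectOn_of_reachSet_nonempty hreach (hw ())
    exact ⟨F, hF, fun _ => hnear⟩

theorem isFactorCriticalFamily_of_isBipartite (hG : G.IsBipartite) :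
    IsFactorCriticalFamily G (Empty.elim : Empty → Set V) where
  nontrivial := nofun
  exists_mem_of_adj u hu v hv huv := by
    obtain ⟨c, -, hodd⟩ := exists_isCycle_odd_length_of_adj hu hv huv
    exact (Nat.not_even_iff_odd.2 hodd
      (SimpleGraph.two_colorable_iff_forall_loop_even.1 hG v c)).elim
  exists_matching _ _ :=
    have ⟨F, hF⟩ := exists_isMaximumMatchingMap G
    ⟨F, hF, nofun⟩

end Pieces

section BAB

variable {V κ : Type*} [Finite V] [Finite κ] {G : SimpleGraph V} {part : V → κ} {u v : V}

theorem partGraph_adj_of_mem_setD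
    (hbd : ∀ p, boundary G {v | part v = p} ⊆ Subtype.val '' (setD (piece G part p))ᶜ)
    (hu : u ∈ setD (partGraph G part)) (huv : G.Adj u v) : (partGraph G part).Adj u v := by
  refine ⟨huv, by_contra fun hne => ?_⟩
  obtain ⟨u', huD, hu'⟩ := hbd (part u) ⟨rfl, v, Ne.symm hne, huv⟩
  exact huD (mem_setD_piece_iff.2 (by rwa [hu']))

theorem isFactorCriticalFamily_of_forall_piece {ι : κ → Type*}
    {Y : ∀ p, ι p → Set {v | part v = p}}
    (hbd : ∀ p, boundary G {v | part v = p} ⊆ Subtype.val '' (setD (piece G part p))ᶜ)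
    (h : ∀ p, IsFactorCriticalFamily (piece G part p) (Y p)) :
    IsFactorCriticalFamily G fun x : Σ p, ι p => Subtype.val '' Y x.1 x.2 :=
  (isFactorCriticalFamily_partGraph h).of_le partGraph_le
    fun _ hu _ => partGraph_adj_of_mem_setD hbd hu

theorem mem_setC_piece_of_mem_setC
    (hbd : ∀ p, boundary G {v | part v = p} ⊆ Subtype.val '' (setD (piece G part p))ᶜ)
    {p : κ} {v : {v | part v = p}} (hv : v.1 ∈ setC G) : v ∈ setC (piece G part p) := by
  obtain ⟨hD, -⟩ := setD_eq_and_isMaximumMatchingMap_of_le partGraph_le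
    fun _ hu _ => partGraph_adj_of_mem_setD hbd hu
  have hvD : v.1 ∉ setD G := fun h => hv (Or.inl h)
  rintro (h | h)
  · exact hvD (hD ▸ mem_setD_piece_iff.1 h)
  · obtain ⟨⟨u, hu, hvu⟩, -⟩ := mem_setA_piece_iff.1 h
    exact hv (Or.inr ⟨⟨u, hD ▸ hu, hvu.1⟩, hvD⟩)

theorem IsBAB.exists_isFactorCriticalFamily_and_isBipartite (hG : IsBAB G) :
    (∃ (ι : Type) (Y : ι → Set V), IsFactorCriticalFamily G Y) ∧
      (G.induce (setC G)).IsBipartite := by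
  obtain ⟨k, part, hbip, hbdB, hparts⟩ := hG
  have hbd : ∀ p, boundary G {v | part v = p} ⊆ Subtype.val '' (setD (piece G part p))ᶜ := by
    rintro (_ | i)
    · exact hbdB.trans (image_mono (setA_union_setC_subset _))
    · exact (hparts i).2.2.2.trans
        (image_mono (subset_union_left.trans (setA_union_setC_subset _)))
  constructor
  · have hpiece : ∀ p, ∃ (ι : Type) (Y : ι → Set {v | part v = p}),
        IsFactorCriticalFamily (piece G part p) Y := by
      rintro (_ | i)
      · exact ⟨_, _, isFactorCriticalFamily_of_isBipartite hbip⟩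
      obtain ⟨⟨C, hC, huniq⟩, -, hreach, -⟩ := hparts i
      obtain ⟨v, -⟩ := id hC
      exact ⟨_, _, isFactorCriticalFamily_of_forall_isOddCycle_eq hC huniq
        (hreach C hC ▸ ⟨v, trivial⟩)⟩
    choose ι Y hY using hpiece
    exact ⟨_, _, isFactorCriticalFamily_of_forall_piece hbd hY⟩
  · have hsub : setC G ⊆ {v | part v = none} := by
      intro v hv
      cases hp : part v with
      | none => exact hp
      | some i =>
        obtain ⟨⟨C, hC, -⟩, -, hreach, -⟩ := hparts i
        have hvC := mem_setC_piece_of_mem_setC hbd (v := ⟨v, hp⟩) hv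
        exact ((setC_eq_empty_of_reachSet_eq_univ (hreach C hC)).subset hvC).elim
    exact hbip.of_hom (SimpleGraph.induceHomOfLE G hsub).toHom

end BAB

end BABGraph

theorem mainTheorem4 {V : Type*} [Finite V] (G : SimpleGraph V) (hG : BABGraph.IsBAB G) :
    BABGraph.nucleus G = BABGraph.isolatedD G ∧
      BABGraph.nucleus G ⊆ BABGraph.diadem G := by
  obtain ⟨⟨ι, Y, hY⟩, hC⟩ := hG.exists_isFactorCriticalFamily_and_isBipartite
  obtain ⟨L, R, hLR⟩ := BABGraph.exists_isBipartitionSetC hC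
  refine ⟨hY.nucleus_eq_isolatedD hLR, fun v hv => ?_⟩
  exact ⟨_, hY.isCriticalIndepSet_isolatedD_union hLR,
    hv _ (hY.isMaximumCriticalIndepSet_isolatedD_union hLR)⟩
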